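/- **The game.** Let $n\ge 1$ and put $n$ chips at the origin of $\mathbb Z$; let $P_t\in\mathbb Z^n$ be the vector of their positions after round $t$, so $P_0=0$. In round $t=1,2,\dots$ a vector $v_t$, uniform in $\{-1,1\}^n$ and independent of everything before, arrives; the player then chooses a sign $x_t\in\{-1,1\}$ knowing only $v_1,\dots,v_t$ (and her own private random coins), and $P_t=P_{t-1}+x_tv_t$. The value after $T$ rounds is $V(n,T)=\|P_T\|_\infty$. **The combined strategy** with parameters $p\in\mathbb N$ and $c,H>0$. Every chip is green or red; initially all chips are green. For $d\in\mathbb Z^n$ let $$\Phi(d)=c^pn^{p-1}\sum_{j=1}^n (cn-d_j^2)^{-p}.$$ For $x\in\mathbb R^n$ let $x^{\rm gr}$ be obtained from $x$ by replacing by $0$ the coordinates of the chips that are red just before the current round $t$. * If $t$ is odd (potential rule on the green chips), $x_t$ is the sign $x$ for which $\Phi\big(P_{t-1}^{\rm gr}+x\,v_t^{\rm gr}\big)$ is smaller. A tie is broken by an arbitrary rule, which may depend on $t$, the current positions and colors, $v_t^{\rm gr}$ and a fair coin (but not on the directions of the red chips). * If $t$ is even (majority rule on all chips), consider all chips $i$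 with $P_{t-1}(i)\ne 0$, and choose $x_t$ so that the strict majority of them move towards $0$; if exactly half of them would move towards $0$, then $x_t$ is the outcome of a fair coin. The coins of different rounds are independent of one another and of the vectors. After the move of round $t$ the chips are recolored: if $\Phi(P_t^{\rm gr})>H$ (with the colors from before the round), all chips become red (a new phase begins); otherwise every red chip that is now at $0$ becomes green, and no other color changes. **Theorem.** For every integer $p\ge 4$ and every $H\ge 4e^3$ there is $c_0>0$ such that for every real $c\ge c_0$ the combined strategy achieves $V(n,T)=O(\sqrt n)$ with high probability, uniformly in the fixed horizon $T$: there is a constant $K=K(p,H,c)$ such that for every $\varepsilon>0$ there is $N$ with $$\Pr\big[V(n,T)\le K\sqrt n\,\big]\ \ge\ 1-\varepsilon$$ for all $n\ge N$, all tie-breaking rules as above, and all $T\ge 0$ (possibly much larger than $n$). -/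

import Mathlib

namespace ChipGame

/-- The configuration of `n` chips on the integers: positions and the set of green chips
(all other chips are red). -/
structure State (n : ℕ) where
  pos : Fin n → ℤ
  green : Finset (Fin n)

/-- Initially all chips are at the origin and green. -/
def State.init (n : ℕ) : State n := ⟨fun _ => 0, Finset.univ⟩

/-- The randomness of one round: the random vector in `{-1, 1}ⁿ`, and a fair coin in `{-1, 1}`
that Carole may use. -/
abbrev Round (n : ℕ) : Type := (Fin n → ℤˣ) × ℤˣ

/-- The vector that agrees with `d` on the chips in `G` and is zero on the other chips. -/
def mask {n : ℕ} (G : Finset (Fin n)) (d : Fin n → ℤ) : Fin n → ℤ :=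
  fun i => if i ∈ G then d i else 0

/-- The potential `Φ(d) = cᵖ nᵖ⁻¹ ∑ⱼ (c n - dⱼ²)⁻ᵖ`. -/
noncomputable def potential (p : ℕ) (c : ℝ) {n : ℕ} (d : Fin n → ℤ) : ℝ :=
  c ^ p * (n : ℝ) ^ (p - 1) * ∑ j, ((c * n - (d j : ℝ) ^ 2) ^ p)⁻¹

/-- A tie-breaking rule for the potential rule. It may use the number of the round, the current
state, the directions of the green chips only (the directions of the red chips are
replaced by zero), and the coin of the round. -/
abbrev TieRule (n : ℕ) : Type := ℕ → State n → (Fin n → ℤ) → ℤˣ → ℤˣ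

/-- Rule 1 on the green chips: choose the sign for which the new potential is smaller, where red
chips are treated as sitting at `0` and not moving. -/
noncomputable def potentialRule (p : ℕ) (c : ℝ) {n : ℕ} (tie : TieRule n) (t : ℕ) (s : State n)
    (r : Round n) : ℤˣ :=
  let d : Fin n → ℤ := mask s.green s.pos
  let w : Fin n → ℤ := mask s.green (fun i => (r.1 i : ℤ))
  if potential p c (d + w) < potential p c (d - w) then 1
  else if potential p c (d - w) < potential p c (d + w) then -1
  else tie t s w r.2

/-- The number of chips not at `0` whose direction `v i` points away from `0`, minus the number
of those whose direction points towards `0`. -/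
def awayExcess {n : ℕ} (s : State n) (v : Fin n → ℤˣ) : ℤ :=
  ∑ i, (s.pos i).sign * (v i : ℤ)

/-- Rule 2 (the majority rule) on all chips: the strict majority of the chips that are not at `0`
moves towards `0`; a tie is decided by the fair coin. -/
def majorityRule {n : ℕ} (s : State n) (r : Round n) : ℤˣ :=
  if 0 < awayExcess s r.1 then -1
  else if awayExcess s r.1 < 0 then 1
  else r.2

/-- The sign chosen in round `t` (rounds are numbered from `1`). -/
noncomputable def chosenSign (p : ℕ) (c : ℝ) {n : ℕ} (tie : TieRule n) (t : ℕ) (s : State n)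
    (r : Round n) : ℤˣ :=
  if Odd t then potentialRule p c tie t s r else majorityRule s r

/-- Round `t`: all chips move by `x • v`. If the potential of the green chips then exceeds `H`,
all chips become red; otherwise the red chips that have reached `0` become green. -/
noncomputable def step (p : ℕ) (c H : ℝ) {n : ℕ} (tie : TieRule n) (t : ℕ) (s : State n)
    (r : Round n) : State n :=
  let x : ℤˣ := chosenSign p c tie t s r
  let P : Fin n → ℤ := fun i => s.pos i + (x : ℤ) * (r.1 i : ℤ)
  { pos := P
    green :=
      if H < potential p c (mask s.green P) then ∅
      else s.green ∪ Finset.univ.filter (fun i => P i = 0) }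

/-- The state after `T` rounds with randomness `ω`. -/
noncomputable def run (p : ℕ) (c H : ℝ) {n : ℕ} (tie : TieRule n) :
    (T : ℕ) → (Fin T → Round n) → State n
  | 0, _ => State.init n
  | T + 1, ω => step p c H tie (T + 1) (run p c H tie T (Fin.init ω)) (ω (Fin.last T))

/-- The value `V(n, T)`: the sup norm of the position vector after `T` rounds. -/
noncomputable def value (p : ℕ) (c H : ℝ) {n : ℕ} (tie : TieRule n) (T : ℕ)
    (ω : Fin T → Round n) : ℝ :=
  ‖(fun i => (((run p c H tie T ω).pos i : ℤ) : ℝ) : Fin n → ℝ)‖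

/-- The probability that `V(n, T) ≤ B`. All vectors and coins of the `T` rounds are
independent and uniform, i.e. `ω` is uniform on the finite set of all outcomes. -/
noncomputable def probValueLE (p : ℕ) (c H : ℝ) {n : ℕ} (tie : TieRule n) (T : ℕ) (B : ℝ) : ℝ :=
  ((PMF.uniformOfFintype (Fin T → Round n)).toOuterMeasure
    {ω | value p c H tie T ω ≤ B}).toReal

end ChipGame

/-!
Let `R = c n`, let `d` be the vector of positions in which red chips are put at `0`, and let
`uⱼ = R / (R - dⱼ²) ≥ 1`. Then the potential `Φ` is the mean of the `uⱼ ^ p`, and recoloring a chip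
that sits at `0` does not change it. A round changes the potential by exactly a second-order term
plus `x A`, where `A = ∑ⱼ aⱼ vⱼ` and `aⱼ` is a symmetric difference of the potential at `dⱼ`
(`potential_mask_add`).

*The potential rarely exceeds `H`.* Let `s² = ∑ⱼ uⱼ ^ (2 p + 2) / (c n³)`. As long as `Φ ≤ H`, the
second-order term is at most of order `s √(H / c)` (`Admissible.sum_curv_le`, by the Cauchy–Schwarz
inequality), and `√(∑ aⱼ²)` is at most of order `s`; if moreover `Φ ≥ H / 2`, it is at least `s`
(`Admissible.scale_sq_le_sum_coef_sq`). The potential rule makes `x A = -|A|`, which by Khintchine's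
inequality has mean at most `-(2 / 5) √(∑ aⱼ²)`, and the majority rule makes the mean of `x A`
nonpositive. Hence for large `c` the gain of an odd round exceeds the second-order losses of that
round and the next one. As `p ≥ 4`, the bound `uⱼ ^ 4 ≤ H n` shows that one round changes `Φ` by
`O(n ^ (-1/4))`; so for `λ` a small multiple of `n ^ (1/4)` the mean of `exp (λ Φ)` contracts over
two rounds up to an additive error `exp (λ H / 2 + 2)`
(`Admissible.expect_expPotential_two_steps_le_add`). A reset only lowers `Φ`, so this holds across
phases, and at every time the probability of a reset is at most a polynomial in `n` times
`exp (-λ H / 2)` (`mean_resetProb_le`), however large the number of rounds is.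

*At a fixed time all chips are green with high probability.* Give a red chip at `z` a weight of
about `exp (|z| / (10 √n))` and a green chip the weight `0`. In odd rounds a red chip makes an unbiased
step, because the potential rule ignores the directions of the red chips. In even rounds it moves
towards `0` with a bias of at least `2 / (5 √n)` (`expect_majorityRule_bias`). Over two rounds the
mean weight therefore contracts by the factor `1 - 1 / (50 n)`, up to a constant multiple of the
probability of a reset, which is the only event that creates weight. All weights vanish initially,
so the mean total weight is always at most a polynomial in `n` times `exp (-λ H / 2)`, which tends to
`0` (`mean_redness_le`, `tendsto_failure`). If no chip is red, then all chips are within `√(c n)` of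
the origin, since their potential has not passed its pole.
-/

namespace ChipGame

open scoped BigOperators

/-! ### Rademacher sums -/

/-- The signed sum `∑ⱼ aⱼ vⱼ`. -/
def signedSum {n : ℕ} (a : Fin n → ℝ) (v : Fin n → ℤˣ) : ℝ := ∑ j, a j * ((v j : ℤ) : ℝ)

lemma expect_units (f : ℤˣ → ℝ) : 𝔼 x, f x = (f 1 + f (-1)) / 2 := by
  rw [Fintype.expect_eq_sum_div_card]
  simp [UnitsInt.univ]

lemma expect_fin_cons {n : ℕ} {α : Type*} [Fintype α] (f : (Fin (n + 1) → α) → ℝ) :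
    𝔼 v, f v = 𝔼 w : Fin n → α, 𝔼 x : α, f (Fin.cons x w) := by
  rw [Finset.expect_comm, ← Finset.expect_product', Finset.univ_product_univ]
  exact (Fintype.expect_equiv (Fin.consEquiv fun _ => α) _ _ fun _ => rfl).symm

lemma signedSum_cons {n : ℕ} (a : Fin (n + 1) → ℝ) (x : ℤˣ) (w : Fin n → ℤˣ) :
    signedSum a (Fin.cons x w) = a 0 * ((x : ℤ) : ℝ) + signedSum (fun j => a j.succ) w := by
  simp [signedSum, Fin.sum_univ_succ]

lemma expect_signedSum_sq {n : ℕ} (a : Fin n → ℝ) :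
    𝔼 v, signedSum a v ^ 2 = ∑ j, a j ^ 2 := by
  induction n with
  | zero => simp [signedSum]
  | succ n ih =>
    have h (w : Fin n → ℤˣ) : 𝔼 x, signedSum a (Fin.cons x w) ^ 2
        = a 0 ^ 2 + signedSum (fun j => a j.succ) w ^ 2 := by
      simp only [expect_units, signedSum_cons]
      push_cast
      ring
    rw [expect_fin_cons, Fin.sum_univ_succ]
    simp only [h, Finset.expect_add_distrib, Fintype.expect_const, ih]

lemma expect_signedSum_pow_four_le {n : ℕ} (a : Fin n → ℝ) :
    𝔼 v, signedSum a v ^ 4 ≤ 3 * (∑ j, a j ^ 2) ^ 2 := by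
  induction n with
  | zero => simp [signedSum]
  | succ n ih =>
    have h (w : Fin n → ℤˣ) : 𝔼 x, signedSum a (Fin.cons x w) ^ 4
        = a 0 ^ 4 + 6 * a 0 ^ 2 * signedSum (fun j => a j.succ) w ^ 2
          + signedSum (fun j => a j.succ) w ^ 4 := by
      simp only [expect_units, signedSum_cons]
      push_cast
      ring
    rw [expect_fin_cons, Fin.sum_univ_succ]
    simp only [h, Finset.expect_add_distrib, Fintype.expect_const, ← Finset.mul_expect,
      expect_signedSum_sq]
    have := ih fun j => a j.succ
    nlinarith [sq_nonneg (a 0 ^ 2)]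

/-- Khintchine's inequality for the first moment, by the fourth moment method. -/
lemma le_expect_abs_signedSum {n : ℕ} (a : Fin n → ℝ) :
    2 / 5 * √(∑ j, a j ^ 2) ≤ 𝔼 v, |signedSum a v| := by
  set S := ∑ j, a j ^ 2 with hS
  have hS0 : 0 ≤ S := Finset.sum_nonneg fun _ _ => sq_nonneg _
  rcases hS0.eq_or_lt with h0 | hpos
  · rw [← h0]
    simpa using Finset.expect_nonneg fun v _ => abs_nonneg (signedSum a v)
  set t := √S with ht
  have ht0 : 0 < t := Real.sqrt_pos.2 hpos
  have htt : t ^ 2 = S := Real.sq_sqrt hS0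
  -- `y ≥ y² - y⁴/4` for `y ≥ 0`, used at `y = |A| / (2 t)`
  have key (v : Fin n → ℤˣ) :
      signedSum a v ^ 2 * (2 * t)⁻¹ - signedSum a v ^ 4 * (32 * t ^ 3)⁻¹ ≤ |signedSum a v| := by
    set y := |signedSum a v| / (2 * t) with hy
    have hy0 : 0 ≤ y := by positivity
    have hA : |signedSum a v| = 2 * t * y := by rw [hy]; field_simp
    have h2 : signedSum a v ^ 2 = (2 * t * y) ^ 2 := by rw [← hA, sq_abs]
    have h4 : signedSum a v ^ 4 = (2 * t * y) ^ 4 := by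
      rw [← hA]; exact (Even.pow_abs (by decide) _).symm
    have h1 : y ^ 2 - y ^ 4 / 4 ≤ y := by
      nlinarith [mul_nonneg hy0 (mul_nonneg hy0 (sq_nonneg (y - 1))),
        mul_nonneg hy0 (sq_nonneg (y - 1)), mul_nonneg hy0 (mul_nonneg (add_nonneg hy0 zero_le_two)
          (sq_nonneg (y - 1)))]
    rw [h2, h4, hA]
    have : (2 * t * y) ^ 2 * (2 * t)⁻¹ - (2 * t * y) ^ 4 * (32 * t ^ 3)⁻¹
        = 2 * t * (y ^ 2 - y ^ 4 / 4) := by field_simp; ring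
    rw [this]
    gcongr
  have h := Finset.expect_le_expect (s := Finset.univ) fun v _ => key v
  rw [Finset.expect_sub_distrib, ← Finset.expect_mul, ← Finset.expect_mul,
    expect_signedSum_sq] at h
  refine le_trans ?_ h
  have h4 : (𝔼 v, signedSum a v ^ 4) * (32 * t ^ 3)⁻¹ ≤ 3 * S ^ 2 * (32 * t ^ 3)⁻¹ := by
    gcongr
    exact expect_signedSum_pow_four_le a
  have e1 : S * (2 * t)⁻¹ = t / 2 := by rw [← htt]; field_simp
  have e2 : 3 * S ^ 2 * (32 * t ^ 3)⁻¹ = 3 / 32 * t := by rw [← htt]; field_simp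
  rw [← hS, e1]
  linarith

/-! ### The bias of the majority rule -/

/-- Exchange the (suitably reflected) directions of the chips `j` and `k`; the excess
`∑ σᵢ vᵢ` is unchanged. -/
def exchange {n : ℕ} (ε : ℤˣ) (j k : Fin n) (v : Fin n → ℤˣ) : Fin n → ℤˣ :=
  fun i => if i = j then ε * v k else if i = k then ε * v j else v i

lemma exchange_involutive {n : ℕ} (ε : ℤˣ) {j k : Fin n} (hjk : j ≠ k) :
    Function.Involutive (exchange ε j k) := by
  have hε : ε * ε = 1 := Int.units_mul_self ε
  intro v
  funext i
  by_cases h1 : i = j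
  · subst h1
    simp [exchange, hjk.symm, ← mul_assoc, hε]
  · by_cases h2 : i = k
    · subst h2
      simp [exchange, h1, ← mul_assoc, hε]
    · simp [exchange, h1, h2]

/-- The sign of an integer as an integer unit, with value `1` at `0`. -/
def unitSign (z : ℤ) : ℤˣ := if z < 0 then -1 else 1

lemma sign_eq_unitSign {z : ℤ} (hz : z ≠ 0) : z.sign = (unitSign z : ℤ) := by
  rcases lt_or_gt_of_ne hz with h | h
  · simp [unitSign, h, Int.sign_eq_neg_one_of_neg h]
  · simp [unitSign, h.not_gt, Int.sign_eq_one_of_pos h]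

lemma units_coe_mul_self (u : ℤˣ) : (u : ℤ) * u = 1 := by
  rw [← Units.val_mul, Int.units_mul_self, Units.val_one]

lemma awayExcess_exchange {n : ℕ} (s : State n) {j k : Fin n} (hjk : j ≠ k) (hj : s.pos j ≠ 0)
    (hk : s.pos k ≠ 0) (v : Fin n → ℤˣ) :
    awayExcess s (exchange (unitSign (s.pos j) * unitSign (s.pos k)) j k v) = awayExcess s v := by
  set σ := unitSign (s.pos j)
  set τ := unitSign (s.pos k)
  have hσ : (σ : ℤ) * σ = 1 := units_coe_mul_self σ
  have hτ : (τ : ℤ) * τ = 1 := units_coe_mul_self τ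
  have split (f : Fin n → ℤ) : ∑ i, f i = f j + f k + ∑ i ∈ (Finset.univ.erase j).erase k, f i := by
    rw [← Finset.add_sum_erase _ _ (Finset.mem_univ j),
      ← Finset.add_sum_erase _ _ (Finset.mem_erase.2 ⟨hjk.symm, Finset.mem_univ k⟩), add_assoc]
  unfold awayExcess
  rw [split, split fun i => (s.pos i).sign * (v i : ℤ), sign_eq_unitSign hj, sign_eq_unitSign hk]
  congr 1
  · simp only [exchange, if_true, hjk.symm, if_false, Units.val_mul]
    linear_combination ((τ : ℤ) * v k) * hσ + ((σ : ℤ) * v j) * hτ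
  · refine Finset.sum_congr rfl fun i hi => ?_
    simp only [Finset.mem_erase] at hi
    simp [exchange, hi.1, hi.2.1]

lemma expect_sign_mul_exchange {n : ℕ} (s : State n) {j k : Fin n} (hj : s.pos j ≠ 0)
    (hk : s.pos k ≠ 0) :
    𝔼 v : Fin n → ℤˣ, (((awayExcess s v).sign * ((s.pos j).sign * (v j : ℤ)) : ℤ) : ℝ)
      = 𝔼 v : Fin n → ℤˣ, (((awayExcess s v).sign * ((s.pos k).sign * (v k : ℤ)) : ℤ) : ℝ) := by
  by_cases hjk : j = k
  · rw [hjk]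
  refine Fintype.expect_equiv (exchange_involutive (unitSign (s.pos j) * unitSign (s.pos k))
    hjk).toPerm _ _ fun v => ?_
  set τ := unitSign (s.pos k) with hτd
  have hτ : (τ : ℤ) * τ = 1 := units_coe_mul_self τ
  rw [Function.Involutive.coe_toPerm, awayExcess_exchange s hjk hj hk, sign_eq_unitSign hj,
    sign_eq_unitSign hk]
  congr 2
  simp only [exchange, Ne.symm hjk, if_false, if_true, Units.val_mul]
  linear_combination (-(unitSign (s.pos j) : ℤ) * v j) * hτ

lemma expect_round {n : ℕ} (f : Round n → ℝ) :
    𝔼 r, f r = 𝔼 v : Fin n → ℤˣ, (f (v, 1) + f (v, -1)) / 2 := by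
  rw [← Finset.univ_product_univ, Finset.expect_product]
  simp only [expect_units]

/-- The coin has mean zero, so ties do not contribute to the mean move of a chip. -/
lemma expect_majorityRule_mul {n : ℕ} (s : State n) (f : (Fin n → ℤˣ) → ℝ) :
    𝔼 r : Round n, ((majorityRule s r : ℤ) : ℝ) * f r.1
      = - 𝔼 v : Fin n → ℤˣ, (((awayExcess s v).sign : ℤ) : ℝ) * f v := by
  rw [expect_round, ← Finset.expect_neg_distrib]
  refine Finset.expect_congr rfl fun v _ => ?_
  rcases lt_trichotomy (awayExcess s v) 0 with h | h | h
  · simp [majorityRule, h, h.not_gt, Int.sign_eq_neg_one_of_neg h]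
  · simp [majorityRule, h]
  · simp [majorityRule, h, Int.sign_eq_one_of_pos h]

/-- Under the majority rule, a chip away from `0` moves towards `0` with a bias of order
`n ^ (-1/2)`: by exchangeability all such chips have the same bias, and the sum of these biases
is the first absolute moment of a Rademacher sum. -/
lemma expect_majorityRule_bias {n : ℕ} (s : State n) {j : Fin n} (hj : s.pos j ≠ 0) :
    𝔼 r : Round n, ((majorityRule s r : ℤ) : ℝ) * (((s.pos j).sign * (r.1 j : ℤ) : ℤ) : ℝ)
      ≤ -(2 / 5 / √n) := by
  rw [expect_majorityRule_mul s fun v => (((s.pos j).sign * (v j : ℤ) : ℤ) : ℝ)]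
  set b := 𝔼 v : Fin n → ℤˣ,
    (((awayExcess s v).sign : ℤ) : ℝ) * (((s.pos j).sign * (v j : ℤ) : ℤ) : ℝ) with hb
  suffices 2 / 5 / √n ≤ b by linarith
  set a : Fin n → ℝ := fun i => ((s.pos i).sign : ℝ) with ha
  set A := Finset.univ.filter fun i => s.pos i ≠ 0 with hA
  have hjA : j ∈ A := by simp [hA, hj]
  have hm : (0 : ℝ) < A.card := by exact_mod_cast Finset.card_pos.2 ⟨j, hjA⟩
  have hS (v : Fin n → ℤˣ) : ((awayExcess s v : ℤ) : ℝ) = signedSum a v := by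
    simp [awayExcess, signedSum, ha]
  have hsq : ∑ i, a i ^ 2 = A.card := by
    have (i : Fin n) : a i ^ 2 = if s.pos i ≠ 0 then 1 else 0 := by
      rcases lt_trichotomy (s.pos i) 0 with h | h | h
      · simp [ha, Int.sign_eq_neg_one_of_neg h, h.ne]
      · simp [ha, h]
      · simp [ha, Int.sign_eq_one_of_pos h, h.ne']
    rw [Finset.sum_congr rfl fun i _ => this i, Finset.sum_boole]
  have hsum : 𝔼 v, |signedSum a v| = A.card * b := by
    have h1 (v : Fin n → ℤˣ) : |signedSum a v| = ∑ i ∈ A,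
        (((awayExcess s v).sign * ((s.pos i).sign * (v i : ℤ)) : ℤ) : ℝ) := by
      rw [← hS, ← Int.cast_abs, ← Int.cast_sum, ← Finset.mul_sum, Int.abs_eq_natAbs,
        ← Int.sign_mul_self_eq_natAbs]
      congr 2
      rw [awayExcess, Finset.sum_filter_of_ne]
      intro i _ hi h0
      simp [h0] at hi
    simp only [h1]
    rw [Finset.expect_sum_comm, Finset.sum_congr rfl (g := fun _ => b), Finset.sum_const,
      nsmul_eq_mul]
    intro i hi
    have hi' : s.pos i ≠ 0 := by simpa [hA] using hi
    rw [expect_sign_mul_exchange s hi' hj, hb]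
    push_cast
    rfl
  have hK := le_expect_abs_signedSum a
  rw [hsum, hsq] at hK
  have hle : √(A.card : ℝ) ≤ √n := by
    apply Real.sqrt_le_sqrt
    exact_mod_cast (Finset.card_le_univ A).trans (by simp)
  have hsp : 0 < √(A.card : ℝ) := Real.sqrt_pos.2 hm
  have hmm : √(A.card : ℝ) * √(A.card : ℝ) = A.card := Real.mul_self_sqrt hm.le
  calc 2 / 5 / √n ≤ 2 / 5 / √(A.card : ℝ) := by gcongr
    _ ≤ b := by
      rw [div_le_iff₀ hsp]
      have : √(A.card : ℝ) * (2 / 5) ≤ √(A.card : ℝ) * (b * √(A.card : ℝ)) := by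
        calc _ = 2 / 5 * √(A.card : ℝ) := by ring
          _ ≤ _ := hK
          _ = √(A.card : ℝ) * √(A.card : ℝ) * b := by rw [hmm]
          _ = _ := by ring
      exact le_of_mul_le_mul_left this hsp

/-! ### The potential of a single chip -/

lemma inv_one_sub_pow_le {p : ℕ} {y : ℝ} (hy : p * |y| ≤ 1 / 2) :
    ((1 - y) ^ p)⁻¹ ≤ 1 + p * y + 2 * (p * y) ^ 2 := by
  rcases Nat.eq_zero_or_pos p with rfl | hp
  · simp
  have hp1 : (1 : ℝ) ≤ p := by exact_mod_cast hp
  have habs : |y| ≤ 1 / 2 := by nlinarith [abs_nonneg y]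
  have hw : |(p : ℝ) * y| ≤ 1 / 2 := by rwa [abs_mul, Nat.abs_cast]
  have h1 := abs_le.1 habs
  have h2 := abs_le.1 hw
  have hB : 1 - p * y ≤ (1 - y) ^ p := by
    have := one_add_mul_le_pow (a := -y) (by linarith) p
    rw [← sub_eq_add_neg] at this
    linarith
  have hpos : 0 < 1 - p * y := by linarith
  calc ((1 - y) ^ p)⁻¹ ≤ (1 - p * y)⁻¹ := inv_anti₀ hpos hB
    _ ≤ _ := by
      rw [inv_le_iff_one_le_mul₀ hpos]
      nlinarith [mul_nonneg (sq_nonneg ((p : ℝ) * y)) (by linarith : (0 : ℝ) ≤ 1 - 2 * (p * y))]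

lemma le_inv_one_sub_pow {p : ℕ} {y : ℝ} (hp : 0 < p) (hy : p * |y| ≤ 1 / 2) :
    1 + p * y ≤ ((1 - y) ^ p)⁻¹ := by
  have hp1 : (1 : ℝ) ≤ p := by exact_mod_cast hp
  have habs : |y| ≤ 1 / 2 := by nlinarith [abs_nonneg y]
  have h1 := abs_le.1 habs
  have h2 : 1 + y ≤ (1 - y)⁻¹ := by
    rw [le_inv_comm₀ (by linarith) (by linarith), inv_eq_one_div, le_div_iff₀ (by linarith)]
    nlinarith [sq_nonneg y]
  calc 1 + p * y ≤ (1 + y) ^ p := one_add_mul_le_pow (by linarith) p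
    _ ≤ ((1 - y)⁻¹) ^ p := by gcongr; linarith
    _ = _ := inv_pow _ _

/-- The relative potential `u = R / (R - x²)` of a chip at `x`, where `R = c n`; the potential
of a configuration is the mean of `u ^ p`. -/
noncomputable def ratio (R x : ℝ) : ℝ := R / (R - x ^ 2)

/-- The first-order coefficient of `u ^ p`: half the difference of its values at the two
neighbours of `x`. -/
noncomputable def slope (p : ℕ) (R x : ℝ) : ℝ := (ratio R (x + 1) ^ p - ratio R (x - 1) ^ p) / 2

/-- The second-order coefficient of `u ^ p`: the mean of its values at the two neighbours
of `x`, minus its value at `x`. -/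
noncomputable def curv (p : ℕ) (R x : ℝ) : ℝ :=
  (ratio R (x + 1) ^ p + ratio R (x - 1) ^ p) / 2 - ratio R x ^ p

lemma ratio_neg (R x : ℝ) : ratio R (-x) = ratio R x := by simp [ratio]

lemma slope_neg (p : ℕ) (R x : ℝ) : slope p R (-x) = -slope p R x := by
  rw [slope, slope, ← ratio_neg R (-x + 1), ← ratio_neg R (-x - 1)]
  ring_nf

lemma slope_zero (p : ℕ) (R : ℝ) : slope p R 0 = 0 := by
  have := slope_neg p R 0
  rw [neg_zero] at this
  linarith

/-- The expansion `u(x + s)ᵖ = u(x)ᵖ + curv + s · slope` for a sign `s` has no remainder. -/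
lemma ratio_add_unit_pow (p : ℕ) (R x : ℝ) (s : ℤˣ) :
    ratio R (x + ((s : ℤ) : ℝ)) ^ p = ratio R x ^ p + curv p R x + ((s : ℤ) : ℝ) * slope p R x := by
  rcases Int.units_eq_one_or s with rfl | rfl
  · simp only [Units.val_one, Int.cast_one, curv, slope]
    ring
  · simp only [Units.val_neg, Units.val_one, Int.cast_neg, Int.cast_one, curv, slope,
      ← sub_eq_add_neg]
    ring

lemma one_le_ratio {R x : ℝ} (h : 0 < R - x ^ 2) : 1 ≤ ratio R x := by
  rw [ratio, le_div_iff₀ h]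
  nlinarith [sq_nonneg x]

section Tame

/-! The hypothesis `2 p (2 |x| + 1) ≤ R - x²` of the following lemmas says that a unit step changes
`R - x²` only by a small factor. -/

variable {p : ℕ} {R x : ℝ}

lemma tame_pos (hp : 0 < p) (h : 2 * p * (2 * |x| + 1) ≤ R - x ^ 2) : 0 < R - x ^ 2 := by
  have : (0 : ℝ) < p := by exact_mod_cast hp
  exact lt_of_lt_of_le (by positivity) h

lemma tame_mul_abs_le (hp : 0 < p) (h : 2 * p * (2 * |x| + 1) ≤ R - x ^ 2) {z : ℝ}
    (hz : |z| ≤ 2 * |x| + 1) : p * |z / (R - x ^ 2)| ≤ 1 / 2 := by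
  have hD := tame_pos hp h
  have hp' : (0 : ℝ) < p := by exact_mod_cast hp
  rw [abs_div, abs_of_pos hD, ← mul_div_assoc, div_le_iff₀ hD]
  nlinarith [mul_le_mul_of_nonneg_left hz hp'.le]

lemma ratio_add_one_pow (h : 0 < R - x ^ 2) :
    ratio R (x + 1) ^ p = ratio R x ^ p * ((1 - (2 * x + 1) / (R - x ^ 2)) ^ p)⁻¹ := by
  rw [← inv_pow, ← mul_pow]
  congr 1
  have : 1 - (2 * x + 1) / (R - x ^ 2) = (R - (x + 1) ^ 2) / (R - x ^ 2) := by
    field_simp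
    ring
  rw [this, inv_div, ratio, ratio]
  field_simp

lemma ratio_sub_one_pow (h : 0 < R - x ^ 2) :
    ratio R (x - 1) ^ p = ratio R x ^ p * ((1 - (-2 * x + 1) / (R - x ^ 2)) ^ p)⁻¹ := by
  have := ratio_add_one_pow (p := p) (R := R) (x := -x) (by simpa using h)
  rw [ratio_neg, neg_sq, ← ratio_neg R (-x + 1)] at this
  convert this using 2 <;> ring_nf

lemma abs_two_mul_add_one_le : |2 * x + 1| ≤ 2 * |x| + 1 := by
  refine (abs_add_le _ _).trans ?_
  simp [abs_mul]

lemma abs_neg_two_mul_add_one_le : |-2 * x + 1| ≤ 2 * |x| + 1 := by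
  refine (abs_add_le _ _).trans ?_
  simp [abs_mul]

lemma curv_le (hp : 0 < p) (hR : 1 ≤ R) (h : 2 * p * (2 * |x| + 1) ≤ R - x ^ 2) :
    curv p R x ≤ 11 * p ^ 2 * ratio R x ^ (p + 2) / R := by
  have hD := tame_pos hp h
  have hp1 : (1 : ℝ) ≤ p := by exact_mod_cast hp
  have hu := one_le_ratio hD
  have h1 := inv_one_sub_pow_le (tame_mul_abs_le hp h abs_two_mul_add_one_le)
  have h2 := inv_one_sub_pow_le (tame_mul_abs_le hp h abs_neg_two_mul_add_one_le)
  set D := R - x ^ 2 with hDdef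
  have hx2 : x ^ 2 = R - D := by rw [hDdef]; ring
  have hDR : D ≤ R := by rw [hDdef]; nlinarith [sq_nonneg x]
  rw [curv, ratio_add_one_pow hD, ratio_sub_one_pow hD, ← hDdef]
  have e : 11 * p ^ 2 * ratio R x ^ (p + 2) / R = ratio R x ^ p * (11 * p ^ 2 * R / D ^ 2) := by
    rw [pow_add, ratio, ← hDdef]
    have : R ≠ 0 := by positivity
    field_simp
  rw [e]
  set U := ratio R x ^ p
  have hU : 0 ≤ U := by positivity
  have key : (((1 - (2 * x + 1) / D) ^ p)⁻¹ + ((1 - (-2 * x + 1) / D) ^ p)⁻¹) / 2 - 1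
      ≤ 11 * p ^ 2 * R / D ^ 2 := by
    have e2 : ((1 + p * ((2 * x + 1) / D) + 2 * (p * ((2 * x + 1) / D)) ^ 2)
        + (1 + p * ((-2 * x + 1) / D) + 2 * (p * ((-2 * x + 1) / D)) ^ 2)) / 2 - 1
        = (p * D + 2 * p ^ 2 * (4 * x ^ 2 + 1)) / D ^ 2 := by
      field_simp
      ring
    have e3 : (p * D + 2 * p ^ 2 * (4 * x ^ 2 + 1)) / D ^ 2 ≤ 11 * p ^ 2 * R / D ^ 2 := by
      apply div_le_div_of_nonneg_right _ (by positivity)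
      rw [hx2]
      nlinarith [mul_nonneg (sub_nonneg.2 hp1) (by positivity : (0 : ℝ) ≤ p * D),
        mul_nonneg (sq_nonneg (p : ℝ)) (sub_nonneg.2 hR),
        mul_nonneg (sq_nonneg (p : ℝ)) (sub_nonneg.2 hDR), mul_nonneg (sq_nonneg (p : ℝ)) hD.le]
    linarith
  calc _ = U * ((((1 - (2 * x + 1) / D) ^ p)⁻¹ + ((1 - (-2 * x + 1) / D) ^ p)⁻¹) / 2 - 1) := by ring
    _ ≤ _ := by gcongr

lemma abs_slope_le (hp : 0 < p) (hR : 1 ≤ R) (h : 2 * p * (2 * |x| + 1) ≤ R - x ^ 2) :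
    |slope p R x| ≤ 6 * p * ratio R x ^ (p + 1) / √R := by
  have hD := tame_pos hp h
  have hp1 : (1 : ℝ) ≤ p := by exact_mod_cast hp
  have hu := one_le_ratio hD
  have hsR : 1 ≤ √R := by rwa [Real.one_le_sqrt]
  have hss : √R * √R = R := Real.mul_self_sqrt (by linarith)
  have hxR : |x| ≤ √R := Real.abs_le_sqrt (by linarith)
  -- both neighbouring values differ from `uᵖ` by a relative error of at most `2 p |y|`
  have aux {z : ℝ} (hz : |z| ≤ 2 * |x| + 1) :
      |((1 - z / (R - x ^ 2)) ^ p)⁻¹ - 1| ≤ 2 * p * ((2 * |x| + 1) / (R - x ^ 2)) := by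
    have hy := tame_mul_abs_le hp h hz
    have h1 := inv_one_sub_pow_le hy
    have h2 := le_inv_one_sub_pow hp hy
    have h3 : |z / (R - x ^ 2)| ≤ (2 * |x| + 1) / (R - x ^ 2) := by
      rw [abs_div, abs_of_pos hD]
      gcongr
    set y := z / (R - x ^ 2)
    have h4 : p * y ≤ p * |y| := by gcongr; exact le_abs_self y
    have h5 : -(p * |y|) ≤ p * y := by
      rw [← mul_neg]; gcongr; exact neg_abs_le y
    have h6 : p * |y| ≤ p * ((2 * |x| + 1) / (R - x ^ 2)) := by gcongr
    have h7 : 0 ≤ p * |y| := by positivity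
    have h8 : (p * y) ^ 2 = (p * |y|) ^ 2 := by rw [mul_pow, mul_pow, sq_abs]
    rw [abs_le]
    constructor
    · linarith
    · nlinarith
  have h1 := aux (z := 2 * x + 1) abs_two_mul_add_one_le
  have h2 := aux (z := -2 * x + 1) abs_neg_two_mul_add_one_le
  rw [slope, ratio_add_one_pow hD, ratio_sub_one_pow hD]
  set D := R - x ^ 2 with hDdef
  set U := ratio R x ^ p with hUdef
  have hU : 0 ≤ U := by positivity
  have e : 6 * p * ratio R x ^ (p + 1) / √R = U * (6 * p * √R / D) := by
    rw [pow_succ, ← hUdef, ratio, ← hDdef]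
    have : √R ≠ 0 := by positivity
    field_simp
    rw [sq, hss]
  have e2 : (U * ((1 - (2 * x + 1) / D) ^ p)⁻¹ - U * ((1 - (-2 * x + 1) / D) ^ p)⁻¹) / 2
      = U * (((((1 - (2 * x + 1) / D) ^ p)⁻¹ - 1) - (((1 - (-2 * x + 1) / D) ^ p)⁻¹ - 1)) / 2) := by
    ring
  rw [e, e2, abs_mul, abs_of_nonneg hU]
  gcongr
  have h3 : 2 * p * ((2 * |x| + 1) / D) ≤ 6 * p * √R / D := by
    rw [← mul_div_assoc]
    apply div_le_div_of_nonneg_right _ hD.le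
    nlinarith
  rw [abs_div, abs_two, div_le_iff₀ two_pos]
  refine (abs_sub _ _).trans ?_
  linarith

lemma le_slope (hp : 0 < p) (h : 2 * p * (2 * |x| + 1) ≤ R - x ^ 2) (hx : 1 ≤ x) :
    p * x * ratio R x ^ p / (R - x ^ 2) ≤ slope p R x := by
  have hD := tame_pos hp h
  have hp1 : (1 : ℝ) ≤ p := by exact_mod_cast hp
  have hu := one_le_ratio hD
  have h1 := le_inv_one_sub_pow hp (tame_mul_abs_le hp h abs_two_mul_add_one_le)
  have h2 := inv_one_sub_pow_le (tame_mul_abs_le hp h abs_neg_two_mul_add_one_le)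
  have h3 : -(1 / 2) ≤ p * ((-2 * x + 1) / (R - x ^ 2)) := neg_le_of_abs_le <| by
    rw [abs_mul, Nat.abs_cast]
    exact tame_mul_abs_le hp h abs_neg_two_mul_add_one_le
  rw [slope, ratio_add_one_pow hD, ratio_sub_one_pow hD]
  set D := R - x ^ 2 with hDdef
  set U := ratio R x ^ p with hUdef
  have hU : 0 ≤ U := by positivity
  set w := p * ((-2 * x + 1) / D) with hw
  have hw0 : w ≤ 0 := by
    rw [hw]
    apply mul_nonpos_of_nonneg_of_nonpos (by positivity)
    apply div_nonpos_of_nonpos_of_nonneg (by linarith) hD.le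
  have h4 : ((1 - (-2 * x + 1) / D) ^ p)⁻¹ ≤ 1 := by nlinarith
  have h5 : p * ((2 * x + 1) / D) = 2 * (p * x / D) + p / D := by field_simp
  have h6 : 0 ≤ p / D := by positivity
  calc p * x * U / D = U * (p * x / D) := by ring
    _ ≤ U * ((((1 - (2 * x + 1) / D) ^ p)⁻¹ - ((1 - (-2 * x + 1) / D) ^ p)⁻¹) / 2) := by
      refine mul_le_mul_of_nonneg_left ?_ hU
      linarith
    _ = _ := by ring

lemma sq_slope_ge_of_one_le (hp : 0 < p) (hR : 0 < R) (h : 2 * p * (2 * |x| + 1) ≤ R - x ^ 2)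
    (hx : 1 ≤ x) :
    p ^ 2 * (ratio R x ^ (2 * p + 2) * (1 - (ratio R x)⁻¹)) / R ≤ slope p R x ^ 2 := by
  have hD := tame_pos hp h
  have hu := one_le_ratio hD
  have h1 := le_slope hp h hx
  refine le_trans (le_of_eq ?_) (pow_le_pow_left₀ (by positivity) h1 2)
  have : (ratio R x ^ (2 * p + 2) * (1 - (ratio R x)⁻¹))
      = (ratio R x ^ p) ^ 2 * (ratio R x ^ 2 * (1 - (ratio R x)⁻¹)) := by ring
  rw [this]
  set U := ratio R x ^ p
  rw [ratio]
  field_simp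
  ring

end Tame

lemma sq_slope_ge {p : ℕ} {R : ℝ} {z : ℤ} (hp : 0 < p) (hR : 0 < R)
    (h : 2 * p * (2 * |(z : ℝ)| + 1) ≤ R - (z : ℝ) ^ 2) :
    p ^ 2 * (ratio R z ^ (2 * p + 2) * (1 - (ratio R z)⁻¹)) / R ≤ slope p R z ^ 2 := by
  rcases lt_trichotomy z 0 with hz | rfl | hz
  · have hz' : (z : ℝ) ≤ -1 := by exact_mod_cast (by omega : z ≤ -1)
    have := sq_slope_ge_of_one_le (x := -(z : ℝ)) hp hR (by simpa using h) (by linarith)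
    rwa [ratio_neg, slope_neg, neg_sq] at this
  · simp [ratio, slope_zero, hR.ne']
  · exact sq_slope_ge_of_one_le hp hR h (by exact_mod_cast hz)

lemma slope_eq_sign_mul_abs {p : ℕ} {R : ℝ} {z : ℤ} (hp : 0 < p)
    (h : 2 * p * (2 * |(z : ℝ)| + 1) ≤ R - (z : ℝ) ^ 2) :
    slope p R z = |slope p R z| * ((z.sign : ℤ) : ℝ) := by
  have aux {x : ℝ} (hx : 1 ≤ x) (h : 2 * p * (2 * |x| + 1) ≤ R - x ^ 2) : 0 ≤ slope p R x := by
    have hD := tame_pos hp h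
    have hu := one_le_ratio hD
    exact le_trans (by positivity) (le_slope hp h hx)
  rcases lt_trichotomy z 0 with hz | rfl | hz
  · have hz' : (z : ℝ) ≤ -1 := by exact_mod_cast (by omega : z ≤ -1)
    have := aux (x := -(z : ℝ)) (by linarith) (by simpa using h)
    rw [slope_neg] at this
    rw [abs_of_nonpos (by linarith), Int.sign_eq_neg_one_of_neg hz]
    simp
  · simp [slope_zero]
  · rw [abs_of_nonneg (aux (by exact_mod_cast hz) h), Int.sign_eq_one_of_pos hz]
    simp

/-- A unit step at most doubles the relative potential of a chip. -/
lemma ratio_step_le {R x y : ℝ} (hR : 0 < R) (hD : 0 < R - x ^ 2)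
    (h : 2 * (2 * |x| + 1) ≤ R - x ^ 2) (hxy : |y - x| ≤ 1) :
    0 < R - y ^ 2 ∧ ratio R y ≤ 2 * ratio R x := by
  have h1 : y ^ 2 ≤ x ^ 2 + (2 * |x| + 1) := by
    have : |y| ≤ |x| + 1 := by
      have := abs_sub_abs_le_abs_sub y x
      linarith
    rw [← sq_abs y, ← sq_abs x]
    nlinarith [abs_nonneg x, abs_nonneg y]
  have h2 : (R - x ^ 2) / 2 ≤ R - y ^ 2 := by linarith
  refine ⟨by linarith, ?_⟩
  calc ratio R y ≤ R / ((R - x ^ 2) / 2) := by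
        unfold ratio
        gcongr
    _ = 2 * ratio R x := by
        unfold ratio
        field_simp

/-! ### The potential of a configuration -/

/-- The range of parameters in which the strategy is analysed. -/
structure Regime (p : ℕ) (c H : ℝ) (n : ℕ) : Prop where
  four_le : 4 ≤ p
  exp_le : 4 * Real.exp 3 ≤ H
  pos : 0 < n
  le : H * (440 * p ^ 2 * 2 ^ (p + 1)) ^ 2 ≤ c

/-- A configuration `d` of green chips (with red chips put at `0`) is admissible if its potential
is at most `H` and no term of the potential has passed the pole at `±√(c n)`. -/
def Admissible (p : ℕ) (c H : ℝ) {n : ℕ} (d : Fin n → ℤ) : Prop :=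
  (∀ j, (d j : ℝ) ^ 2 < c * n) ∧ potential p c d ≤ H

namespace Regime

variable {p n : ℕ} {c H : ℝ}

lemma p_pos (h : Regime p c H n) : 0 < p := by have := h.four_le; omega

lemma four_le_cast (h : Regime p c H n) : (4 : ℝ) ≤ p := by exact_mod_cast h.four_le

lemma one_le_H (h : Regime p c H n) : 1 ≤ H := by
  have := h.exp_le
  have := Real.add_one_le_exp (3 : ℝ)
  linarith

lemma n_pos (h : Regime p c H n) : (0 : ℝ) < n := by exact_mod_cast h.pos

lemma one_le_n (h : Regime p c H n) : (1 : ℝ) ≤ n := by exact_mod_cast h.pos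

lemma pow_four_le (h : Regime p c H n) : H * (6 * p) ^ 4 ≤ c := by
  have h2 : (1 : ℝ) ≤ 2 ^ (p + 1) := one_le_pow₀ one_le_two
  have h1 := h.one_le_H
  have hp := h.four_le_cast
  refine le_trans ?_ h.le
  gcongr
  calc (6 * p : ℝ) ^ 4 = (36 * p ^ 2 * 1) ^ 2 := by ring
    _ ≤ _ := by gcongr; norm_num

lemma one_le_c (h : Regime p c H n) : 1 ≤ c := by
  have hp := h.four_le_cast
  have h1 : (1 : ℝ) ≤ (6 * p) ^ 4 := one_le_pow₀ (by linarith)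
  nlinarith [h.pow_four_le, h.one_le_H]

lemma one_le_mul (h : Regime p c H n) : 1 ≤ c * n :=
  one_le_mul_of_one_le_of_one_le h.one_le_c h.one_le_n

end Regime

section Potential

variable {p n : ℕ} {c H : ℝ} {d : Fin n → ℤ}

lemma potential_eq (hp : 0 < p) (hn : 0 < n) (d : Fin n → ℤ) :
    potential p c d = (∑ j, ratio (c * n) (d j) ^ p) / n := by
  have hn' : (n : ℝ) ≠ 0 := by positivity
  obtain ⟨q, rfl⟩ : ∃ q, p = q + 1 := ⟨p - 1, by omega⟩
  rw [potential, Finset.mul_sum, Finset.sum_div]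
  refine Finset.sum_congr rfl fun j _ => ?_
  rw [ratio, div_pow, Nat.add_sub_cancel, mul_pow,
    pow_succ (n : ℝ)]
  field_simp

lemma potential_zero (hp : 0 < p) (hn : 0 < n) (hc : 0 < c) :
    potential p c (0 : Fin n → ℤ) = 1 := by
  have hn' : (n : ℝ) ≠ 0 := by positivity
  rw [potential_eq hp hn]
  simp [ratio, hc.ne', hn']

namespace Admissible

lemma pos_sub (hd : Admissible p c H d) (j : Fin n) : 0 < c * n - (d j : ℝ) ^ 2 :=
  sub_pos.2 (hd.1 j)

lemma one_le_ratio (hd : Admissible p c H d) (j : Fin n) : 1 ≤ ratio (c * n) (d j) :=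
  ChipGame.one_le_ratio (hd.pos_sub j)

lemma sum_ratio_pow_le (hd : Admissible p c H d) (h : Regime p c H n) :
    ∑ j, ratio (c * n) (d j) ^ p ≤ H * n := by
  have := hd.2
  rwa [potential_eq h.p_pos h.pos, div_le_iff₀ h.n_pos] at this

lemma ratio_pow_four_le (hd : Admissible p c H d) (h : Regime p c H n) (j : Fin n) :
    ratio (c * n) (d j) ^ 4 ≤ H * n := by
  refine (pow_le_pow_right₀ (hd.one_le_ratio j) h.four_le).trans
    (le_trans ?_ (hd.sum_ratio_pow_le h))
  exact Finset.single_le_sum (f := fun j => ratio (c * n) (d j) ^ p)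
    (fun j _ => pow_nonneg (zero_le_one.trans (hd.one_le_ratio j)) _) (Finset.mem_univ j)

lemma ratio_le (hd : Admissible p c H d) (h : Regime p c H n) (j : Fin n) :
    ratio (c * n) (d j) ≤ √√(H * n) := by
  have h1 := hd.ratio_pow_four_le h j
  apply Real.le_sqrt_of_sq_le
  apply Real.le_sqrt_of_sq_le
  rwa [← pow_mul]

/-- As `u ≤ (H n)^(1/4)`, the distance of a chip from the pole is of larger order than its
position, so that a unit step is a small perturbation. -/
lemma tame (hd : Admissible p c H d) (h : Regime p c H n) (j : Fin n) :
    2 * p * (2 * |(d j : ℝ)| + 1) ≤ c * n - (d j : ℝ) ^ 2 := by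
  have hD := hd.pos_sub j
  have hR := h.one_le_mul
  have hu := hd.one_le_ratio j
  have hsR : 1 ≤ √(c * n) := by rwa [Real.one_le_sqrt]
  have hss : √(c * n) * √(c * n) = c * n := Real.mul_self_sqrt (by linarith)
  have hx : |(d j : ℝ)| ≤ √(c * n) := Real.abs_le_sqrt (by linarith)
  have hp := h.four_le_cast
  have key : 6 * p * ratio (c * n) (d j) ≤ √(c * n) := by
    refine le_of_pow_le_pow_left₀ (n := 4) (by norm_num) (by positivity) ?_
    have e : √(c * n) ^ 4 = (c * n) * (c * n) := by
      calc √(c * n) ^ 4 = (√(c * n) * √(c * n)) * (√(c * n) * √(c * n)) := by ring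
        _ = _ := by rw [hss]
    rw [e, mul_pow]
    have h1 : 1 * n ≤ c * n := by gcongr; exact h.one_le_c
    calc (6 * p : ℝ) ^ 4 * ratio (c * n) (d j) ^ 4 ≤ (6 * p : ℝ) ^ 4 * (H * n) := by
          gcongr; exact hd.ratio_pow_four_le h j
      _ = (H * (6 * p) ^ 4) * n := by ring
      _ ≤ c * n := by gcongr; exact h.pow_four_le
      _ ≤ _ := le_mul_of_one_le_left (by linarith) hR
  have hD' : c * n - (d j : ℝ) ^ 2 = c * n / ratio (c * n) (d j) := by
    rw [ratio]
    have : c * n ≠ 0 := by positivity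
    rw [div_div_cancel₀ this]
  rw [hD', le_div_iff₀ (by linarith)]
  calc 2 * p * (2 * |(d j : ℝ)| + 1) * ratio (c * n) (d j)
      ≤ 2 * p * (3 * √(c * n)) * ratio (c * n) (d j) := by gcongr; linarith
    _ = (6 * p * ratio (c * n) (d j)) * √(c * n) := by ring
    _ ≤ √(c * n) * √(c * n) := by gcongr
    _ = _ := hss

end Admissible

/-! ### One round: first-order coefficients and second-order error -/

/-- The coefficient of the direction of chip `j` in the change of the potential. -/
noncomputable def coef (p : ℕ) (c : ℝ) {n : ℕ} (d : Fin n → ℤ) (j : Fin n) : ℝ :=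
  slope p (c * n) (d j) / n

/-- The size `√(∑ⱼ uⱼ ^ (2 p + 2) / (c n³))` of the fluctuation of the potential in one round. -/
noncomputable def scale (p : ℕ) (c : ℝ) {n : ℕ} (d : Fin n → ℤ) : ℝ :=
  √((∑ j, ratio (c * n) (d j) ^ (2 * p + 2)) / (c * n ^ 3))

/-- The move of all chips by `x • v` changes the potential of the green chips by a second-order
term and a signed sum. -/
lemma potential_mask_add (hp : 0 < p) (hn : 0 < n) (G : Finset (Fin n)) (P : Fin n → ℤ)
    (v : Fin n → ℤˣ) (x : ℤˣ) :
    potential p c (mask G fun i => P i + (x : ℤ) * (v i : ℤ))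
      = potential p c (mask G P) + (∑ j ∈ G, curv p (c * n) (mask G P j)) / n
        + ((x : ℤ) : ℝ) * signedSum (coef p c (mask G P)) v := by
  have hn' : (n : ℝ) ≠ 0 := by positivity
  rw [potential_eq hp hn, potential_eq hp hn, signedSum, Finset.mul_sum, ← add_div,
    ← Finset.sum_add_sum_compl G, ← Finset.sum_add_sum_compl G fun j => ratio (c * n) _ ^ p,
    ← Finset.sum_add_sum_compl G fun j => ((x : ℤ) : ℝ) * _]
  have h1 : ∑ j ∈ G, ratio (c * n) (mask G (fun i => P i + (x : ℤ) * (v i : ℤ)) j : ℤ) ^ p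
      = ∑ j ∈ G, (ratio (c * n) (mask G P j : ℤ) ^ p + curv p (c * n) (mask G P j)
        + n * (((x : ℤ) : ℝ) * (coef p c (mask G P) j * ((v j : ℤ) : ℝ)))) := by
    refine Finset.sum_congr rfl fun j hj => ?_
    have := ratio_add_unit_pow p (c * n) (P j) (x * v j)
    simp only [mask, hj, if_true, coef]
    push_cast at this ⊢
    rw [this]
    field_simp
  have h2 : ∑ j ∈ Gᶜ, ratio (c * n) (mask G (fun i => P i + (x : ℤ) * (v i : ℤ)) j : ℤ) ^ p
      = ∑ j ∈ Gᶜ, ratio (c * n) (mask G P j : ℤ) ^ p := by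
    refine Finset.sum_congr rfl fun j hj => ?_
    simp [mask, Finset.mem_compl.1 hj]
  have h3 : ∑ j ∈ Gᶜ, ((x : ℤ) : ℝ) * (coef p c (mask G P) j * ((v j : ℤ) : ℝ)) = 0 := by
    refine Finset.sum_eq_zero fun j hj => ?_
    simp [mask, Finset.mem_compl.1 hj, coef, slope_zero]
  rw [h1, h2, h3, Finset.sum_add_distrib, Finset.sum_add_distrib, ← Finset.mul_sum]
  field_simp
  ring

lemma scale_nonneg : 0 ≤ scale p c d := Real.sqrt_nonneg _

namespace Admissible

lemma scale_sq (hd : Admissible p c H d) (h : Regime p c H n) :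
    scale p c d ^ 2 = (∑ j, ratio (c * n) (d j) ^ (2 * p + 2)) / (c * n ^ 3) := by
  have hc := h.one_le_c
  refine Real.sq_sqrt (div_nonneg (Finset.sum_nonneg fun j _ => ?_) (by positivity))
  exact pow_nonneg (zero_le_one.trans (hd.one_le_ratio j)) _

/-- The second-order term; the sum of the `u ^ (p + 2)` is bounded by the Cauchy–Schwarz
inequality, using that the sum of the `u ^ 2` is at most `H n`. -/
lemma sum_curv_le (hd : Admissible p c H d) (h : Regime p c H n) (G : Finset (Fin n)) :
    (∑ j ∈ G, curv p (c * n) (d j)) / n ≤ 11 * p ^ 2 * √(H / c) * scale p c d := by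
  have hc := h.one_le_c
  have hH := h.one_le_H
  have hn := h.n_pos
  have hu (j : Fin n) : 0 ≤ ratio (c * n) (d j) := zero_le_one.trans (hd.one_le_ratio j)
  set S := ∑ j, ratio (c * n) (d j) ^ (2 * p + 2) with hS
  have hS0 : 0 ≤ S := Finset.sum_nonneg fun j _ => pow_nonneg (hu j) _
  have h1 : ∑ j ∈ G, curv p (c * n) (d j)
      ≤ 11 * p ^ 2 / (c * n) * ∑ j, ratio (c * n) (d j) ^ (p + 2) := by
    rw [Finset.mul_sum]
    refine le_trans (Finset.sum_le_sum fun j _ => ?_) (Finset.sum_le_sum_of_subset_of_nonneg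
      (Finset.subset_univ G) fun j _ _ => mul_nonneg (by positivity) (pow_nonneg (hu j) _))
    refine (curv_le h.p_pos h.one_le_mul (hd.tame h j)).trans (le_of_eq ?_)
    ring
  have h2 : ∑ j, ratio (c * n) (d j) ^ (p + 2) ≤ √S * √(H * n) := by
    have := Real.sum_mul_le_sqrt_mul_sqrt Finset.univ (fun j => ratio (c * n) (d j) ^ (p + 1))
      fun j => ratio (c * n) (d j)
    calc _ = ∑ j, ratio (c * n) (d j) ^ (p + 1) * ratio (c * n) (d j) :=
          Finset.sum_congr rfl fun j _ => by ring
      _ ≤ _ := this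
      _ ≤ _ := by
        gcongr
        · rw [hS]
          refine le_of_eq (Finset.sum_congr rfl fun j _ => ?_)
          rw [← pow_mul]
          ring_nf
        · refine le_trans (Finset.sum_le_sum fun j _ => ?_) (hd.sum_ratio_pow_le h)
          exact pow_le_pow_right₀ (hd.one_le_ratio j) (by have := h.four_le; omega)
  calc (∑ j ∈ G, curv p (c * n) (d j)) / n
      ≤ (11 * p ^ 2 / (c * n) * (√S * √(H * n))) / n := by
        gcongr
        exact h1.trans (by gcongr)
    _ = _ := by
      rw [scale, ← hS, Real.sqrt_div' _ (by linarith), Real.sqrt_div' _ (by positivity),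
        Real.sqrt_mul (by linarith) (n : ℝ), Real.sqrt_mul (by linarith) ((n : ℝ) ^ 3)]
      have e : √((n : ℝ) ^ 3) = n * √n := by
        rw [pow_succ, Real.sqrt_mul (by positivity), Real.sqrt_sq hn.le]
      have e3 : √c ≠ 0 := by positivity
      have e4 : √(n : ℝ) ≠ 0 := by positivity
      rw [e]
      field_simp
      rw [Real.sq_sqrt hn.le, Real.sq_sqrt (by linarith)]
      ring

lemma sum_coef_sq_le (hd : Admissible p c H d) (h : Regime p c H n) :
    ∑ j, coef p c d j ^ 2 ≤ (6 * p * scale p c d) ^ 2 := by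
  have hc := h.one_le_c
  have hn := h.n_pos
  have hR := h.one_le_mul
  rw [mul_pow, hd.scale_sq h, ← mul_div_assoc, Finset.mul_sum, Finset.sum_div]
  refine Finset.sum_le_sum fun j _ => ?_
  have hu : 0 ≤ ratio (c * n) (d j) := zero_le_one.trans (hd.one_le_ratio j)
  rw [coef, div_pow, ← sq_abs]
  calc |slope p (c * n) (d j)| ^ 2 / (n : ℝ) ^ 2
      ≤ (6 * p * ratio (c * n) (d j) ^ (p + 1) / √(c * n)) ^ 2 / (n : ℝ) ^ 2 := by
        gcongr
        exact abs_slope_le h.p_pos hR (hd.tame h j)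
    _ = _ := by
      rw [div_pow, Real.sq_sqrt (by linarith), mul_pow, ← pow_mul]
      field_simp
      ring

/-- If the potential is at least `H / 2`, the chips with `u > 1 + 1 / p` dominate: all others
contribute at most `e ^ 3 ≤ H / 4` to the mean of `u ^ (2 p + 2)`. -/
lemma scale_sq_le_sum_coef_sq (hd : Admissible p c H d) (h : Regime p c H n)
    (hΦ : H / 2 ≤ potential p c d) : scale p c d ^ 2 ≤ ∑ j, coef p c d j ^ 2 := by
  have hc := h.one_le_c
  have hn := h.n_pos
  have hp := h.four_le_cast
  set M := ∑ j, ratio (c * n) (d j) ^ (2 * p + 2) with hM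
  set M' := ∑ j, ratio (c * n) (d j) ^ (2 * p + 2) * (1 - (ratio (c * n) (d j))⁻¹) with hM'
  have h1 : M ≤ (p + 1) * M' + n * Real.exp 3 := by
    have : (n : ℝ) * Real.exp 3 = ∑ _j : Fin n, Real.exp 3 := by simp
    rw [hM, hM', this, Finset.mul_sum, ← Finset.sum_add_distrib]
    refine Finset.sum_le_sum fun j _ => ?_
    set u := ratio (c * n) (d j)
    have hu : 1 ≤ u := hd.one_le_ratio j
    have hui : 0 ≤ 1 - u⁻¹ := sub_nonneg.2 (inv_le_one_of_one_le₀ hu)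
    rcases le_total u (1 + 1 / p) with hle | hge
    · have : u ^ (2 * p + 2) ≤ Real.exp 3 := by
        calc u ^ (2 * p + 2) ≤ (Real.exp (1 / p)) ^ (2 * p + 2) := by
              gcongr
              rw [add_comm] at hle
              exact hle.trans (Real.add_one_le_exp _)
          _ = Real.exp ((2 * p + 2 : ℕ) * (1 / p)) := (Real.exp_nat_mul _ _).symm
          _ ≤ _ := by
            apply Real.exp_le_exp.2
            push_cast
            rw [mul_one_div, div_le_iff₀ (by linarith)]
            linarith
      have : 0 ≤ (p + 1) * (u ^ (2 * p + 2) * (1 - u⁻¹)) := by positivity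
      linarith
    · have h2 : 1 ≤ (p + 1) * (1 - u⁻¹) := by
        have : u⁻¹ ≤ p / (p + 1) := by
          rw [inv_le_comm₀ (by linarith) (by positivity), inv_div]
          refine le_trans (le_of_eq ?_) hge
          field_simp
        have h3 : (p : ℝ) / (p + 1) * (p + 1) = p := by field_simp
        nlinarith
      have h4 : 0 ≤ u ^ (2 * p + 2) := by positivity
      have := Real.exp_pos 3
      nlinarith [mul_le_mul_of_nonneg_left h2 h4]
  have h2 : n * (2 * Real.exp 3) ≤ M := by
    rw [potential_eq h.p_pos h.pos, le_div_iff₀ hn] at hΦ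
    have h3 : ∑ j, ratio (c * n) (d j) ^ p ≤ M :=
      Finset.sum_le_sum fun j _ => pow_le_pow_right₀ (hd.one_le_ratio j) (by omega)
    have := h.exp_le
    nlinarith
  have h3 : M ≤ 2 * (p + 1) * M' := by linarith
  have hM'0 : 0 ≤ M' := by
    have : 0 ≤ M := le_trans (by positivity) h2
    by_contra hneg
    nlinarith
  have h4 : p ^ 2 * M' / (c * n ^ 3) ≤ ∑ j, coef p c d j ^ 2 := by
    rw [hM', Finset.mul_sum, Finset.sum_div]
    refine Finset.sum_le_sum fun j _ => ?_
    have := sq_slope_ge h.p_pos (by positivity) (hd.tame h j)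
    rw [coef, div_pow, le_div_iff₀ (by positivity)]
    refine le_trans (le_of_eq ?_) this
    field_simp
  rw [hd.scale_sq h, ← hM]
  refine le_trans ?_ h4
  gcongr
  calc M ≤ 2 * (p + 1) * M' := h3
    _ ≤ p ^ 2 * M' := by gcongr; nlinarith

lemma abs_signedSum_coef_le (hd : Admissible p c H d) (h : Regime p c H n) (v : Fin n → ℤˣ) :
    |signedSum (coef p c d) v| ≤ 6 * p * H * √√(H * n) / √(c * n) := by
  have hc := h.one_le_c
  have hn := h.n_pos
  have hR := h.one_le_mul
  have hsR : 0 < √(c * n) := Real.sqrt_pos.2 (by linarith)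
  refine (Finset.abs_sum_le_sum_abs _ _).trans ?_
  have h1 (j : Fin n) : |coef p c d j * ((v j : ℤ) : ℝ)|
      ≤ 6 * p * √√(H * n) / (√(c * n) * n) * ratio (c * n) (d j) ^ p := by
    have hu : 0 ≤ ratio (c * n) (d j) := zero_le_one.trans (hd.one_le_ratio j)
    have hv : |((v j : ℤ) : ℝ)| = 1 := by
      rw [← Int.cast_abs, Int.isUnit_iff_abs_eq.1 (v j).isUnit, Int.cast_one]
    rw [abs_mul, hv, mul_one, coef, abs_div, Nat.abs_cast]
    calc |slope p (c * n) (d j)| / n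
        ≤ 6 * p * ratio (c * n) (d j) ^ (p + 1) / √(c * n) / n := by
          gcongr
          exact abs_slope_le h.p_pos hR (hd.tame h j)
      _ = 6 * p * ratio (c * n) (d j) / (√(c * n) * n) * ratio (c * n) (d j) ^ p := by
          rw [pow_succ]
          field_simp
      _ ≤ _ := by gcongr; exact hd.ratio_le h j
  refine (Finset.sum_le_sum fun j _ => h1 j).trans ?_
  rw [← Finset.mul_sum]
  calc _ ≤ 6 * p * √√(H * n) / (√(c * n) * n) * (H * n) := by
        gcongr
        exact hd.sum_ratio_pow_le h
    _ = _ := by field_simp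

end Admissible

/-! ### The exponential rate -/

/-- The rate `λ` in the exponential `exp (λ Φ)`, of order `n ^ (1/4)`. -/
noncomputable def rate (p : ℕ) (H : ℝ) (n : ℕ) : ℝ := √√n / (1440 * p ^ 2 * 4 ^ (p + 1) * H ^ 2)

lemma rate_pos (h : Regime p c H n) : 0 < rate p H n := by
  have := h.n_pos
  have := h.one_le_H
  have := h.four_le_cast
  unfold rate
  positivity

namespace Admissible

lemma rate_mul_scale_le (hd : Admissible p c H d) (h : Regime p c H n) :
    1440 * p ^ 2 * 4 ^ (p + 1) * (rate p H n * scale p c d) ≤ 1 := by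
  have hc := h.one_le_c
  have hH := h.one_le_H
  have hn := h.n_pos
  have hp := h.four_le_cast
  have hHn : 0 ≤ H * n := by positivity
  suffices √√n * scale p c d ≤ H ^ 2 by
    have e : 1440 * p ^ 2 * 4 ^ (p + 1) * (rate p H n * scale p c d)
        = √√n * scale p c d / H ^ 2 := by
      unfold rate
      field_simp
    rw [e]
    exact div_le_one_of_le₀ this (by positivity)
  refine le_of_pow_le_pow_left₀ two_ne_zero (by positivity) ?_
  rw [mul_pow, Real.sq_sqrt (Real.sqrt_nonneg _), hd.scale_sq h]
  -- `u ^ (p + 2) = u ^ p u ^ 2 ≤ (H n) ^ (3/2)`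
  have h1 : ∑ j, ratio (c * n) (d j) ^ (2 * p + 2) ≤ H * n * √(H * n) * (H * n) := by
    calc _ ≤ ∑ j, H * n * √(H * n) * ratio (c * n) (d j) ^ p := by
          refine Finset.sum_le_sum fun j _ => ?_
          have hu : 0 ≤ ratio (c * n) (d j) := zero_le_one.trans (hd.one_le_ratio j)
          have h2 : ratio (c * n) (d j) ^ 2 ≤ √(H * n) := by
            apply Real.le_sqrt_of_sq_le
            rw [← pow_mul]
            exact hd.ratio_pow_four_le h j
          have h3 : ratio (c * n) (d j) ^ p ≤ H * n := le_trans
            (Finset.single_le_sum (f := fun j => ratio (c * n) (d j) ^ p)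
              (fun j _ => pow_nonneg (zero_le_one.trans (hd.one_le_ratio j)) _) (Finset.mem_univ j))
            (hd.sum_ratio_pow_le h)
          calc ratio (c * n) (d j) ^ (2 * p + 2)
              = ratio (c * n) (d j) ^ p * ratio (c * n) (d j) ^ 2 * ratio (c * n) (d j) ^ p := by
                ring
            _ ≤ _ := by gcongr
      _ ≤ _ := by
        rw [← Finset.mul_sum]
        gcongr
        exact hd.sum_ratio_pow_le h
  have hsn : √(n : ℝ) * √n = n := Real.mul_self_sqrt hn.le
  have hsH : √H ≤ H := by
    rw [Real.sqrt_le_left (by linarith)]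
    nlinarith
  calc √n * ((∑ j, ratio (c * n) (d j) ^ (2 * p + 2)) / (c * n ^ 3))
      ≤ √n * (H * n * √(H * n) * (H * n) / (1 * n ^ 3)) := by gcongr
    _ = H ^ 2 * √H * (√n * √n) / n := by
      rw [Real.sqrt_mul (by linarith)]
      field_simp
    _ = H ^ 2 * √H := by rw [hsn]; field_simp
    _ ≤ H ^ 2 * H := by gcongr
    _ ≤ H ^ 2 * H * H := le_mul_of_one_le_right (by positivity) hH
    _ = _ := by ring

lemma rate_mul_abs_signedSum_le (hd : Admissible p c H d) (h : Regime p c H n)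
    (v : Fin n → ℤˣ) : rate p H n * |signedSum (coef p c d) v| ≤ 1 / 2 := by
  have hc := h.one_le_c
  have hH := h.one_le_H
  have hn := h.n_pos
  have hp := h.four_le_cast
  have h4 : (1 : ℝ) ≤ 4 ^ (p + 1) := one_le_pow₀ (by norm_num)
  have hl : ∀ x : ℝ, 1 ≤ x → √x ≤ x := fun x hx => by
    rw [Real.sqrt_le_left (by linarith)]
    nlinarith
  have hsH : √√H ≤ H :=
    (Real.sqrt_le_sqrt (hl H hH)).trans (hl H hH)
  have hsc : 1 ≤ √c := by rwa [Real.one_le_sqrt]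
  have hsn : √√(n : ℝ) * √√n = √n := Real.mul_self_sqrt (Real.sqrt_nonneg _)
  have hspos : 0 < √(n : ℝ) := Real.sqrt_pos.2 hn
  calc rate p H n * |signedSum (coef p c d) v|
      ≤ rate p H n * (6 * p * H * √√(H * n) / √(c * n)) := by
        have := (rate_pos h).le
        gcongr
        exact hd.abs_signedSum_coef_le h v
    _ = 6 * p * H * √√H * (√√n * √√n) / (1440 * p ^ 2 * 4 ^ (p + 1) * H ^ 2 * √c * √n) := by
        unfold rate
        rw [Real.sqrt_mul (by linarith) (n : ℝ), Real.sqrt_mul (by linarith) (n : ℝ),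
          Real.sqrt_mul (Real.sqrt_nonneg _)]
        field_simp
    _ = 6 * p * H * √√H / (1440 * p ^ 2 * 4 ^ (p + 1) * H ^ 2 * √c) := by
        rw [hsn]
        field_simp
    _ ≤ 6 * p * H * H / (1440 * p ^ 2 * 1 * H ^ 2 * 1) := by gcongr
    _ = 6 / (1440 * p) := by field_simp
    _ ≤ 1 / 2 := by
      rw [div_le_div_iff₀ (by positivity) two_pos]
      linarith

end Admissible

/-- The choice of `c` makes the second-order term small compared with the fluctuation. -/
lemma rate_mul_curv_le (h : Regime p c H n) :
    rate p H n * (11 * p ^ 2 * √(H / c) * scale p c d)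
      ≤ rate p H n * scale p c d / (40 * 2 ^ (p + 1)) := by
  have hc := h.one_le_c
  have hH := h.one_le_H
  have hp := h.four_le_cast
  have h1 : √(H / c) ≤ (440 * (p : ℝ) ^ 2 * 2 ^ (p + 1))⁻¹ := by
    rw [Real.sqrt_le_left (by positivity), inv_pow, div_le_iff₀ (by linarith),
      inv_mul_eq_div, le_div_iff₀ (by positivity)]
    exact h.le
  have h2 : 0 ≤ rate p H n * scale p c d := mul_nonneg (rate_pos h).le scale_nonneg
  calc rate p H n * (11 * p ^ 2 * √(H / c) * scale p c d)
      = rate p H n * scale p c d * (11 * p ^ 2) * √(H / c) := by ring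
    _ ≤ rate p H n * scale p c d * (11 * p ^ 2) * (440 * (p : ℝ) ^ 2 * 2 ^ (p + 1))⁻¹ := by gcongr
    _ = _ := by field_simp; ring

end Potential

/-! ### One round of the strategy -/

/-- The positions of the green chips, with the red chips put at `0`. -/
def State.greenPos {n : ℕ} (s : State n) : Fin n → ℤ := mask s.green s.pos

/-- A new phase begins after round `t`. -/
def Resets (p : ℕ) (c H : ℝ) {n : ℕ} (tie : TieRule n) (t : ℕ) (s : State n) (r : Round n) : Prop :=
  H < potential p c (mask s.green (step p c H tie t s r).pos)

section Step

variable {p n : ℕ} {c H : ℝ} {tie : TieRule n} {t : ℕ} {s : State n}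

lemma greenPos_step_of_resets {r : Round n} (h : Resets p c H tie t s r) :
    (step p c H tie t s r).greenPos = 0 := by
  have : (step p c H tie t s r).green = ∅ := if_pos h
  funext i
  simp [State.greenPos, this, mask]

/-- Red chips turn green at `0`, where they contribute to the potential as much as before. -/
lemma greenPos_step_of_not_resets {r : Round n} (h : ¬ Resets p c H tie t s r) :
    (step p c H tie t s r).greenPos = mask s.green (step p c H tie t s r).pos := by
  have : (step p c H tie t s r).green = s.green ∪ Finset.univ.filter
    (fun i => (step p c H tie t s r).pos i = 0) := if_neg h
  funext i
  rw [State.greenPos, this]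
  by_cases hi : i ∈ s.green
  · simp [mask, hi]
  · by_cases h0 : (step p c H tie t s r).pos i = 0
    · simp [mask, h0]
    · simp [mask, hi, h0]

lemma abs_mask_step_sub_le (r : Round n) (j : Fin n) :
    |((mask s.green (step p c H tie t s r).pos j : ℤ) : ℝ) - (s.greenPos j : ℤ)| ≤ 1 := by
  by_cases hj : j ∈ s.green
  · simp only [mask, State.greenPos, hj, if_true, step]
    rcases Int.units_eq_one_or (chosenSign p c tie t s r) with h | h <;>
    rcases Int.units_eq_one_or (r.1 j) with h' | h' <;> simp [h, h']
  · simp [mask, State.greenPos, hj]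

lemma admissible_zero (h : Regime p c H n) : Admissible p c H (0 : Fin n → ℤ) := by
  have hc := h.one_le_c
  have hn := h.n_pos
  refine ⟨fun j => ?_, ?_⟩
  · simpa using mul_pos (zero_lt_one.trans_le hc) hn
  · rw [potential_zero h.p_pos h.pos (by linarith)]
    exact h.one_le_H

lemma Admissible.step (hs : Admissible p c H s.greenPos) (h : Regime p c H n) (r : Round n) :
    Admissible p c H (ChipGame.step p c H tie t s r).greenPos := by
  by_cases hr : Resets p c H tie t s r
  · rw [greenPos_step_of_resets hr]
    exact admissible_zero h
  · rw [greenPos_step_of_not_resets hr]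
    refine ⟨fun j => ?_, not_lt.1 hr⟩
    have ht := hs.tame h j
    have hp := h.four_le_cast
    have := (ratio_step_le (by linarith [h.one_le_mul]) (hs.pos_sub j)
      (le_trans (by nlinarith [abs_nonneg ((s.greenPos j : ℤ) : ℝ)]) ht)
      (abs_mask_step_sub_le (p := p) (c := c) (H := H) (tie := tie) (t := t) r j)).1
    linarith

lemma Admissible.scale_step_le (hs : Admissible p c H s.greenPos) (h : Regime p c H n)
    (r : Round n) : scale p c (ChipGame.step p c H tie t s r).greenPos
      ≤ 2 ^ (p + 1) * scale p c s.greenPos := by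
  have hc := h.one_le_c
  have hs' := hs.step (tie := tie) (t := t) h r
  have hratio (j : Fin n) : ratio (c * n) ((ChipGame.step p c H tie t s r).greenPos j)
      ≤ 2 * ratio (c * n) (s.greenPos j) := by
    by_cases hr : Resets p c H tie t s r
    · rw [greenPos_step_of_resets hr]
      have := hs.one_le_ratio j
      have h1 : c * n ≠ 0 := by linarith [h.one_le_mul]
      have h2 : ratio (c * n) (((0 : Fin n → ℤ) j : ℤ) : ℝ) = 1 := by
        simp only [ratio, Pi.zero_apply, Int.cast_zero]
        rw [zero_pow two_ne_zero, sub_zero, div_self h1]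
      rw [h2]
      linarith
    · rw [greenPos_step_of_not_resets hr]
      have hp := h.four_le_cast
      exact (ratio_step_le (by linarith [h.one_le_mul]) (hs.pos_sub j)
        (le_trans (by nlinarith [abs_nonneg ((s.greenPos j : ℤ) : ℝ)]) (hs.tame h j))
        (abs_mask_step_sub_le r j)).2
  refine le_of_pow_le_pow_left₀ two_ne_zero (mul_nonneg (by positivity) scale_nonneg) ?_
  rw [mul_pow, hs.scale_sq h, hs'.scale_sq h, ← mul_div_assoc, Finset.mul_sum]
  gcongr with j _
  rw [← pow_mul, mul_comm (p + 1) 2, mul_add, mul_one, ← mul_pow]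
  exact pow_le_pow_left₀ (zero_le_one.trans (hs'.one_le_ratio j)) (hratio j) _

lemma potential_mask_step (h : Regime p c H n) (r : Round n) :
    potential p c (mask s.green (step p c H tie t s r).pos)
      = potential p c s.greenPos + (∑ j ∈ s.green, curv p (c * n) (s.greenPos j)) / n
        + ((chosenSign p c tie t s r : ℤ) : ℝ) * signedSum (coef p c s.greenPos) r.1 :=
  potential_mask_add h.p_pos h.pos s.green s.pos r.1 (chosenSign p c tie t s r)

/-- The potential rule makes the first-order change of the potential negative. -/
lemma potentialRule_mul (h : Regime p c H n) (r : Round n) :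
    ((potentialRule p c tie t s r : ℤ) : ℝ) * signedSum (coef p c s.greenPos) r.1
      = -|signedSum (coef p c s.greenPos) r.1| := by
  have h1 := potential_mask_add (c := c) h.p_pos h.pos s.green s.pos r.1 1
  have h2 := potential_mask_add (c := c) h.p_pos h.pos s.green s.pos r.1 (-1)
  have e1 : mask s.green (fun i => s.pos i + ((1 : ℤˣ) : ℤ) * (r.1 i : ℤ))
      = mask s.green s.pos + mask s.green fun i => (r.1 i : ℤ) := by
    funext i
    by_cases hi : i ∈ s.green <;> simp [mask, hi]
  have e2 : mask s.green (fun i => s.pos i + ((-1 : ℤˣ) : ℤ) * (r.1 i : ℤ))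
      = mask s.green s.pos - mask s.green fun i => (r.1 i : ℤ) := by
    funext i
    by_cases hi : i ∈ s.green <;> simp [mask, hi, sub_eq_add_neg]
  rw [e1] at h1
  rw [e2] at h2
  simp only [Units.val_one, Units.val_neg, Int.cast_one, Int.cast_neg] at h1 h2
  change _ = _ + _ + 1 * signedSum (coef p c s.greenPos) r.1 at h1
  change _ = _ + _ + -1 * signedSum (coef p c s.greenPos) r.1 at h2
  set A := signedSum (coef p c s.greenPos) r.1
  unfold potentialRule
  simp only [h1, h2]
  rcases lt_trichotomy A 0 with hA | hA | hA
  · rw [if_pos (by linarith), abs_of_neg hA]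
    simp
  · simp [hA]
  · rw [if_neg (by linarith), if_pos (by linarith), abs_of_pos hA]
    simp

/-! ### Exponential drift of the potential -/

/-- The exponential of the potential of the green chips. -/
noncomputable def expPotential (p : ℕ) (c H : ℝ) {n : ℕ} (s : State n) : ℝ :=
  Real.exp (rate p H n * potential p c s.greenPos)

/-- A reset lowers the potential, so it suffices to bound the potential before the recoloring. -/
lemma expPotential_step_le (h : Regime p c H n) (r : Round n) :
    expPotential p c H (step p c H tie t s r)
      ≤ Real.exp (rate p H n * potential p c (mask s.green (step p c H tie t s r).pos)) := by
  have hl := (rate_pos h).le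
  unfold expPotential
  by_cases hr : Resets p c H tie t s r
  · rw [greenPos_step_of_resets hr, potential_zero h.p_pos h.pos (by linarith [h.one_le_c])]
    have : 1 ≤ potential p c (mask s.green (step p c H tie t s r).pos) := h.one_le_H.trans hr.le
    gcongr
  · rw [greenPos_step_of_not_resets hr]

namespace Admissible

lemma rate_mul_curv_le_half (hs : Admissible p c H s.greenPos) (h : Regime p c H n) :
    rate p H n * scale p c s.greenPos / (40 * 2 ^ (p + 1)) ≤ 1 / 2 := by
  have h1 := hs.rate_mul_scale_le h
  have hp := h.four_le_cast
  have h2 : (1 : ℝ) ≤ 2 ^ (p + 1) := one_le_pow₀ one_le_two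
  have h4 : (1 : ℝ) ≤ 4 ^ (p + 1) := one_le_pow₀ (by norm_num)
  have h0 : 0 ≤ rate p H n * scale p c s.greenPos := mul_nonneg (rate_pos h).le scale_nonneg
  have h5 : 1 ≤ 1440 * (p : ℝ) ^ 2 * 4 ^ (p + 1) := by
    have : 1 ≤ 1440 * (p : ℝ) ^ 2 := by nlinarith
    exact one_le_mul_of_one_le_of_one_le this h4
  rw [div_le_iff₀ (by positivity)]
  nlinarith

/-- A round changes the exponent `λ Φ` by at most the sum of a small positive second-order term
and the first-order term. -/
lemma rate_mul_potential_step_le (hs : Admissible p c H s.greenPos) (h : Regime p c H n)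
    (r : Round n) :
    rate p H n * potential p c (mask s.green (ChipGame.step p c H tie t s r).pos)
      ≤ rate p H n * potential p c s.greenPos
        + (rate p H n * scale p c s.greenPos / (40 * 2 ^ (p + 1))
          + rate p H n * (((chosenSign p c tie t s r : ℤ) : ℝ)
            * signedSum (coef p c s.greenPos) r.1)) := by
  have h1 := mul_le_mul_of_nonneg_left (hs.sum_curv_le h s.green) (rate_pos h).le
  have h2 := rate_mul_curv_le (d := s.greenPos) h
  rw [potential_mask_step h]
  linarith

lemma rate_mul_abs_first_order_le (hs : Admissible p c H s.greenPos) (h : Regime p c H n)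
    (v : Fin n → ℤˣ) (x : ℤˣ) :
    |rate p H n * (((x : ℤ) : ℝ) * signedSum (coef p c s.greenPos) v)| ≤ 1 / 2 := by
  have hx : |((x : ℤ) : ℝ)| = 1 := by
    rw [← Int.cast_abs, Int.isUnit_iff_abs_eq.1 x.isUnit, Int.cast_one]
  rw [abs_mul, abs_mul, hx, one_mul, abs_of_pos (rate_pos h)]
  exact hs.rate_mul_abs_signedSum_le h v

lemma potential_mask_step_le (hs : Admissible p c H s.greenPos) (h : Regime p c H n)
    (r : Round n) :
    rate p H n * potential p c (mask s.green (ChipGame.step p c H tie t s r).pos)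
      ≤ rate p H n * potential p c s.greenPos + 1 := by
  have h1 := hs.rate_mul_potential_step_le (tie := tie) (t := t) h r
  have h2 := hs.rate_mul_curv_le_half h
  have h3 := (abs_le.1 (hs.rate_mul_abs_first_order_le h r.1 (chosenSign p c tie t s r))).2
  linarith

lemma expPotential_step_le_mul (hs : Admissible p c H s.greenPos) (h : Regime p c H n)
    (r : Round n) :
    expPotential p c H (ChipGame.step p c H tie t s r) ≤ Real.exp 1 * expPotential p c H s := by
  refine (expPotential_step_le h r).trans ?_
  rw [expPotential, ← Real.exp_add, Real.exp_le_exp]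
  linarith [hs.potential_mask_step_le (tie := tie) (t := t) h r]

/-- Second-order bound for the exponential of the change of `λ Φ` in one round. -/
lemma expPotential_step_le_quadratic (hs : Admissible p c H s.greenPos) (h : Regime p c H n)
    (r : Round n) :
    expPotential p c H (ChipGame.step p c H tie t s r) ≤ expPotential p c H s
      * (1 + 2 * (rate p H n * scale p c s.greenPos / (40 * 2 ^ (p + 1)))
        + rate p H n * (((chosenSign p c tie t s r : ℤ) : ℝ)
          * signedSum (coef p c s.greenPos) r.1)
        + 2 * rate p H n ^ 2 * signedSum (coef p c s.greenPos) r.1 ^ 2) := by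
  have h1 := hs.rate_mul_potential_step_le (tie := tie) (t := t) h r
  have h2 := hs.rate_mul_curv_le_half h
  have h3 := hs.rate_mul_abs_first_order_le h r.1 (chosenSign p c tie t s r)
  have h0 : 0 ≤ rate p H n * scale p c s.greenPos / (40 * 2 ^ (p + 1)) :=
    div_nonneg (mul_nonneg (rate_pos h).le scale_nonneg) (by positivity)
  refine (expPotential_step_le h r).trans ((Real.exp_le_exp.2 h1).trans ?_)
  rw [Real.exp_add, expPotential]
  refine mul_le_mul_of_nonneg_left ?_ (Real.exp_pos _).le
  have hsq : (rate p H n * (((chosenSign p c tie t s r : ℤ) : ℝ)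
      * signedSum (coef p c s.greenPos) r.1)) ^ 2
      = rate p H n ^ 2 * signedSum (coef p c s.greenPos) r.1 ^ 2 := by
    have : ((chosenSign p c tie t s r : ℤ) : ℝ) * ((chosenSign p c tie t s r : ℤ) : ℝ) = 1 := by
      exact_mod_cast units_coe_mul_self (chosenSign p c tie t s r)
    linear_combination (rate p H n ^ 2 * signedSum (coef p c s.greenPos) r.1 ^ 2) * this
  have e : 2 * rate p H n ^ 2 * signedSum (coef p c s.greenPos) r.1 ^ 2
    = 2 * (rate p H n ^ 2 * signedSum (coef p c s.greenPos) r.1 ^ 2) := by ring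
  rw [e, ← hsq]
  set q := rate p H n * scale p c s.greenPos / (40 * 2 ^ (p + 1))
  set y := rate p H n * (((chosenSign p c tie t s r : ℤ) : ℝ)
    * signedSum (coef p c s.greenPos) r.1)
  have h4 : |q + y| ≤ 1 := (abs_add_le _ _).trans (by rw [abs_of_nonneg h0]; linarith)
  have h5 := (abs_le.1 (Real.abs_exp_sub_one_sub_id_le h4)).2
  nlinarith [sq_nonneg (q - y)]

lemma rate_sq_mul_sum_le (hs : Admissible p c H s.greenPos) (h : Regime p c H n) :
    2 * rate p H n ^ 2 * ∑ j, coef p c s.greenPos j ^ 2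
      ≤ 72 * p ^ 2 * (rate p H n * scale p c s.greenPos) ^ 2 := by
  have := mul_le_mul_of_nonneg_left (hs.sum_coef_sq_le h) (sq_nonneg (rate p H n))
  nlinarith

/-- In an odd round the potential has a negative drift, unless it is small. -/
lemma expect_expPotential_step_odd_le (hs : Admissible p c H s.greenPos) (h : Regime p c H n)
    (ht : Odd t) (hΦ : H / 2 ≤ potential p c s.greenPos) :
    𝔼 r, expPotential p c H (ChipGame.step p c H tie t s r)
      ≤ expPotential p c H s * (1 - rate p H n * scale p c s.greenPos / 5) := by
  have hl := rate_pos h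
  have hp := h.four_le_cast
  have hx := hs.rate_mul_scale_le h
  have hsc : 0 ≤ scale p c s.greenPos := scale_nonneg
  set σ := √(∑ j, coef p c s.greenPos j ^ 2) with hσ
  have hσ0 : 0 ≤ σ := Real.sqrt_nonneg _
  have hσ2 : σ ^ 2 = ∑ j, coef p c s.greenPos j ^ 2 :=
    Real.sq_sqrt (Finset.sum_nonneg fun _ _ => sq_nonneg _)
  have h1 : scale p c s.greenPos ≤ σ := Real.le_sqrt_of_sq_le (hs.scale_sq_le_sum_coef_sq h hΦ)
  have h2 : σ ≤ 6 * p * scale p c s.greenPos := by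
    rw [hσ, Real.sqrt_le_left (by positivity)]
    exact hs.sum_coef_sq_le h
  refine (Finset.expect_le_expect fun r _ => hs.expPotential_step_le_quadratic h r).trans ?_
  rw [← Finset.mul_expect]
  refine mul_le_mul_of_nonneg_left ?_ (Real.exp_pos _).le
  simp only [chosenSign, ht, if_true, potentialRule_mul h]
  rw [expect_round]
  simp only [add_self_div_two]
  rw [Finset.expect_add_distrib, Finset.expect_add_distrib, Fintype.expect_const,
    ← Finset.mul_expect, ← Finset.mul_expect, Finset.expect_neg_distrib, expect_signedSum_sq, ← hσ2]
  have h3 := mul_le_mul_of_nonneg_left (le_expect_abs_signedSum (coef p c s.greenPos)) hl.le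
  rw [← hσ] at h3
  have h4 : rate p H n * scale p c s.greenPos ≤ rate p H n * σ := by gcongr
  have h5 : rate p H n * scale p c s.greenPos / (40 * 2 ^ (p + 1))
      ≤ rate p H n * scale p c s.greenPos / (40 * 1) := by
    have h0 : (1 : ℝ) ≤ 2 ^ (p + 1) := one_le_pow₀ one_le_two
    gcongr
  have h6 : rate p H n * σ ≤ 1 / 20 := by
    have h40 : (1 : ℝ) ≤ 4 ^ (p + 1) := one_le_pow₀ (by norm_num)
    have h7 : rate p H n * σ ≤ rate p H n * (6 * p * scale p c s.greenPos) := by gcongr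
    have h8 : 1440 * p * 1 * 1 * (rate p H n * scale p c s.greenPos)
        ≤ 1440 * p * p * 4 ^ (p + 1) * (rate p H n * scale p c s.greenPos) := by gcongr; linarith
    nlinarith
  have h9 : 2 * rate p H n ^ 2 * σ ^ 2 ≤ rate p H n * σ / 10 := by
    have := mul_le_mul_of_nonneg_left h6 (mul_nonneg hl.le hσ0)
    nlinarith
  have h10 : 0 ≤ rate p H n * scale p c s.greenPos := mul_nonneg hl.le hsc
  linarith

/-- By the bias of the majority rule, the first-order term of the potential has a nonpositive mean
in an even round. -/
lemma expect_majorityRule_mul_signedSum_le (hs : Admissible p c H s.greenPos)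
    (h : Regime p c H n) :
    𝔼 r : Round n, ((majorityRule s r : ℤ) : ℝ) * signedSum (coef p c s.greenPos) r.1 ≤ 0 := by
  have e (r : Round n) : ((majorityRule s r : ℤ) : ℝ) * signedSum (coef p c s.greenPos) r.1
      = ∑ j, |coef p c s.greenPos j| * (((majorityRule s r : ℤ) : ℝ)
        * ((((s.greenPos j).sign) * (r.1 j : ℤ) : ℤ) : ℝ)) := by
    rw [signedSum, Finset.mul_sum]
    refine Finset.sum_congr rfl fun j _ => ?_
    have : coef p c s.greenPos j = |coef p c s.greenPos j| * (((s.greenPos j).sign : ℤ) : ℝ) := by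
      rw [coef, abs_div, Nat.abs_cast]
      nth_rw 1 [slope_eq_sign_mul_abs h.p_pos (hs.tame h j)]
      ring
    nth_rw 1 [this]
    push_cast
    ring
  simp only [e]
  rw [Finset.expect_sum_comm]
  refine Finset.sum_nonpos fun j _ => ?_
  rw [← Finset.mul_expect]
  by_cases h0 : s.greenPos j = 0
  · simp [h0]
  · have hg : s.greenPos j = s.pos j := by
      by_cases hj : j ∈ s.green
      · simp [State.greenPos, mask, hj]
      · simp [State.greenPos, mask, hj] at h0
    rw [hg] at h0 ⊢
    refine mul_nonpos_of_nonneg_of_nonpos (abs_nonneg _) ?_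
    exact (expect_majorityRule_bias s h0).trans (neg_nonpos.2 (by positivity))

lemma expect_expPotential_step_even_le (hs : Admissible p c H s.greenPos) (h : Regime p c H n)
    (ht : ¬ Odd t) :
    𝔼 r, expPotential p c H (ChipGame.step p c H tie t s r)
      ≤ expPotential p c H s * (1 + rate p H n * scale p c s.greenPos / (20 * 2 ^ (p + 1))
        + 72 * p ^ 2 * (rate p H n * scale p c s.greenPos) ^ 2) := by
  have hl := rate_pos h
  refine (Finset.expect_le_expect fun r _ => hs.expPotential_step_le_quadratic h r).trans ?_
  rw [← Finset.mul_expect]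
  refine mul_le_mul_of_nonneg_left ?_ (Real.exp_pos _).le
  simp only [chosenSign, ht, if_false]
  rw [Finset.expect_add_distrib, Finset.expect_add_distrib, Fintype.expect_const,
    ← Finset.mul_expect, ← Finset.mul_expect]
  have h1 := mul_nonpos_of_nonneg_of_nonpos hl.le (hs.expect_majorityRule_mul_signedSum_le h)
  have h2 : 𝔼 r : Round n, signedSum (coef p c s.greenPos) r.1 ^ 2
      = ∑ j, coef p c s.greenPos j ^ 2 := by
    rw [expect_round]
    simp only [add_self_div_two, expect_signedSum_sq]
  rw [h2]
  have h3 := hs.rate_sq_mul_sum_le h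
  have h4 : 2 * (rate p H n * scale p c s.greenPos / (40 * 2 ^ (p + 1)))
      = rate p H n * scale p c s.greenPos / (20 * 2 ^ (p + 1)) := by
    field_simp
    ring
  linarith

/-- Over an odd round and the following even round, the gain of the odd round outweighs the loss
of the even round. -/
lemma expect_expPotential_two_steps_le (hs : Admissible p c H s.greenPos) (h : Regime p c H n)
    (ht : Odd t) (hΦ : H / 2 ≤ potential p c s.greenPos) :
    𝔼 r, 𝔼 r', expPotential p c H
        (ChipGame.step p c H tie (t + 1) (ChipGame.step p c H tie t s r) r')
      ≤ (1 - rate p H n * scale p c s.greenPos / 10) * expPotential p c H s := by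
  have hl := rate_pos h
  have hsc : 0 ≤ scale p c s.greenPos := scale_nonneg
  have hx := hs.rate_mul_scale_le h
  set x := rate p H n * scale p c s.greenPos with hxdef
  have hx0 : 0 ≤ x := mul_nonneg hl.le hsc
  have hev : ¬ Odd (t + 1) := Nat.not_odd_iff_even.2 ht.add_one
  have hfac (r : Round n) : 𝔼 r', expPotential p c H
      (ChipGame.step p c H tie (t + 1) (ChipGame.step p c H tie t s r) r')
      ≤ expPotential p c H (ChipGame.step p c H tie t s r) * (1 + x / 10) := by
    have hs' := hs.step (tie := tie) (t := t) h r
    refine (hs'.expect_expPotential_step_even_le h hev).trans ?_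
    refine mul_le_mul_of_nonneg_left ?_ (Real.exp_pos _).le
    set x' := rate p H n * scale p c (ChipGame.step p c H tie t s r).greenPos with hx'
    have hx'0 : 0 ≤ x' := mul_nonneg hl.le scale_nonneg
    have hxx : x' ≤ 2 ^ (p + 1) * x := by
      calc x' ≤ rate p H n * (2 ^ (p + 1) * scale p c s.greenPos) := by
            rw [hx']
            gcongr
            exact hs.scale_step_le h r
        _ = _ := by rw [hxdef]; ring
    have h1 : x' / (20 * 2 ^ (p + 1)) ≤ x / 20 := by
      rw [div_le_div_iff₀ (by positivity) (by norm_num)]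
      linarith
    have h2 : 72 * p ^ 2 * x' ^ 2 ≤ x / 20 := by
      calc 72 * p ^ 2 * x' ^ 2 ≤ 72 * p ^ 2 * (2 ^ (p + 1) * x) ^ 2 := by gcongr
        _ = (1440 * p ^ 2 * 4 ^ (p + 1) * x) * (x / 20) := by
          rw [mul_pow, ← pow_mul, mul_comm (p + 1) 2, pow_mul]
          norm_num
          ring
        _ ≤ 1 * (x / 20) := by gcongr
        _ = _ := one_mul _
    linarith
  refine (Finset.expect_le_expect fun r _ => hfac r).trans ?_
  rw [← Finset.expect_mul]
  refine (mul_le_mul_of_nonneg_right (hs.expect_expPotential_step_odd_le h ht hΦ)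
    (by linarith)).trans ?_
  rw [← hxdef, mul_assoc, mul_comm]
  refine mul_le_mul_of_nonneg_right ?_ (Real.exp_pos _).le
  nlinarith

lemma inv_le_scale (hs : Admissible p c H s.greenPos) (h : Regime p c H n) :
    (√c * n)⁻¹ ≤ scale p c s.greenPos := by
  have hc := h.one_le_c
  have hn := h.n_pos
  refine le_of_pow_le_pow_left₀ two_ne_zero scale_nonneg ?_
  rw [hs.scale_sq h, inv_pow, mul_pow, Real.sq_sqrt (by linarith), inv_eq_one_div,
    div_le_div_iff₀ (by positivity) (by positivity)]
  have : (n : ℝ) ≤ ∑ j, ratio (c * n) (s.greenPos j) ^ (2 * p + 2) := by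
    calc (n : ℝ) = ∑ _j : Fin n, (1 : ℝ) := by simp
      _ ≤ _ := Finset.sum_le_sum fun j _ => one_le_pow₀ (hs.one_le_ratio j)
  calc 1 * (c * (n : ℝ) ^ 3) = n * (c * n ^ 2) := by ring
    _ ≤ _ := by gcongr

end Admissible

/-- A lower bound for the relative decrease of the mean of `exp (λ Φ)` over two rounds. -/
noncomputable def decay (p : ℕ) (c H : ℝ) (n : ℕ) : ℝ := rate p H n * (√c * n)⁻¹ / 10

lemma Admissible.decay_le_one (hs : Admissible p c H s.greenPos) (h : Regime p c H n) :
    decay p c H n ≤ 1 := by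
  have h1 := hs.inv_le_scale h
  have h2 := hs.rate_mul_scale_le h
  have h3 : (1 : ℝ) ≤ 4 ^ (p + 1) := one_le_pow₀ (by norm_num)
  have hp := h.four_le_cast
  have h5 : 1 ≤ 1440 * (p : ℝ) ^ 2 * 4 ^ (p + 1) :=
    one_le_mul_of_one_le_of_one_le (by nlinarith) h3
  have h7 := mul_le_mul_of_nonneg_left h1 (rate_pos h).le
  have h8 : 0 ≤ rate p H n * (√c * n)⁻¹ := mul_nonneg (rate_pos h).le (by positivity)
  unfold decay
  nlinarith

lemma Admissible.expect_expPotential_two_steps_le_add (hs : Admissible p c H s.greenPos)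
    (h : Regime p c H n) (ht : Odd t) :
    𝔼 r, 𝔼 r', expPotential p c H
        (ChipGame.step p c H tie (t + 1) (ChipGame.step p c H tie t s r) r')
      ≤ (1 - decay p c H n) * expPotential p c H s + Real.exp (rate p H n * (H / 2) + 2) := by
  have hl := rate_pos h
  have hY : 0 ≤ expPotential p c H s := (Real.exp_pos _).le
  have hdec : decay p c H n ≤ rate p H n * scale p c s.greenPos / 10 := by
    have := hs.inv_le_scale h
    unfold decay
    gcongr
  have hdec1 := hs.decay_le_one h
  rcases le_total (H / 2) (potential p c s.greenPos) with hΦ | hΦ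
  · refine (hs.expect_expPotential_two_steps_le h ht hΦ).trans ?_
    have := Real.exp_pos (rate p H n * (H / 2) + 2)
    nlinarith
  · have h1 (r r' : Round n) : expPotential p c H
        (ChipGame.step p c H tie (t + 1) (ChipGame.step p c H tie t s r) r')
        ≤ Real.exp (rate p H n * (H / 2) + 2) := by
      refine ((hs.step h r).expPotential_step_le_mul h r').trans ?_
      calc _ ≤ Real.exp 1 * (Real.exp 1 * expPotential p c H s) := by
            gcongr
            exact hs.expPotential_step_le_mul h r
        _ = Real.exp (rate p H n * potential p c s.greenPos + 2) := by
            rw [expPotential, ← Real.exp_add, ← Real.exp_add]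
            ring_nf
        _ ≤ _ := by gcongr
    have h2 : 𝔼 r, 𝔼 r', expPotential p c H
        (ChipGame.step p c H tie (t + 1) (ChipGame.step p c H tie t s r) r')
        ≤ Real.exp (rate p H n * (H / 2) + 2) :=
      Finset.expect_le Finset.univ_nonempty fun r _ =>
        Finset.expect_le Finset.univ_nonempty fun r' _ => h1 r r'
    have : 0 ≤ (1 - decay p c H n) * expPotential p c H s := mul_nonneg (by linarith) hY
    linarith

/-- A reset happens only if the potential was already within `1 / λ` of `H`. -/
lemma Admissible.indicator_resets_le (hs : Admissible p c H s.greenPos) (h : Regime p c H n)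
    (r : Round n) [Decidable (Resets p c H tie t s r)] :
    (if Resets p c H tie t s r then (1 : ℝ) else 0)
      ≤ Real.exp (1 - rate p H n * H) * expPotential p c H s := by
  split_ifs with hr
  · rw [expPotential, ← Real.exp_add, Real.one_le_exp_iff]
    have h1 := hs.potential_mask_step_le (tie := tie) (t := t) h r
    have h2 := mul_le_mul_of_nonneg_left (le_of_lt hr) (rate_pos h).le
    linarith
  · exact mul_nonneg (Real.exp_pos _).le (Real.exp_pos _).le

end Step

/-! ### Red chips -/

/-- The exponential rate `1 / (10 √n)` for the distance of a red chip from `0`. -/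
noncomputable def redRate (n : ℕ) : ℝ := 1 / (10 * √n)

/-- The weight of a chip at `z`, which vanishes at `0`. -/
noncomputable def liveWeight (n : ℕ) (z : ℤ) : ℝ :=
  if z = 0 then 0 else Real.exp (redRate n * |(z : ℝ)|)

/-- The weight of a red chip at `z`. A chip at `0` is red only if a new phase began in the round in
which it arrived there; its weight is chosen such that it is halved when the chip leaves `0`. -/
noncomputable def redWeight (n : ℕ) (z : ℤ) : ℝ :=
  if z = 0 then 2 * Real.exp (redRate n) else Real.exp (redRate n * |(z : ℝ)|)

/-- The weight of chip `i` in the state `s`; green chips have weight `0`. -/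
noncomputable def redness {n : ℕ} (s : State n) (i : Fin n) : ℝ :=
  if i ∈ s.green then 0 else redWeight n (s.pos i)

/-- A bound for the weight of a chip that turns red. -/
noncomputable def resetCost (c : ℝ) : ℝ := 2 * Real.exp (√c + 1)

/-- The factor by which the mean weight of a red chip changes in an even round. -/
noncomputable def evenFactor (n : ℕ) : ℝ :=
  Real.cosh (redRate n) - 2 / 5 / √n * Real.sinh (redRate n)

section Red

variable {p n : ℕ} {c H : ℝ} {tie : TieRule n} {t : ℕ} {s : State n}

lemma redRate_nonneg : 0 ≤ redRate n := by
  unfold redRate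
  positivity

lemma redRate_le_one (hn : 0 < n) : redRate n ≤ 1 := by
  have : 1 ≤ √(n : ℝ) := by
    rw [Real.one_le_sqrt]
    exact_mod_cast hn
  unfold redRate
  rw [div_le_one (by positivity)]
  linarith

lemma redRate_mul_sqrt (hn : 0 < n) (hc : 0 ≤ c) : redRate n * √(c * n) ≤ √c := by
  have : 0 < √(n : ℝ) := Real.sqrt_pos.2 (by exact_mod_cast hn)
  rw [redRate, Real.sqrt_mul hc]
  have e : 1 / (10 * √n) * (√c * √n) = √c / 10 := by field_simp
  rw [e]
  linarith [Real.sqrt_nonneg c]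

lemma one_le_redWeight (z : ℤ) : 1 ≤ redWeight n z := by
  have h := redRate_nonneg (n := n)
  have h1 := Real.one_le_exp h
  unfold redWeight
  split_ifs
  · linarith
  · exact Real.one_le_exp (by positivity)

lemma redness_nonneg (s : State n) (i : Fin n) : 0 ≤ redness s i := by
  unfold redness
  split_ifs
  · exact le_rfl
  · exact zero_le_one.trans (one_le_redWeight _)

lemma liveWeight_neg (z : ℤ) : liveWeight n (-z) = liveWeight n z := by
  simp [liveWeight]

lemma liveWeight_le (z : ℤ) : liveWeight n z ≤ Real.exp (redRate n * |(z : ℝ)|) := by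
  unfold liveWeight
  split_ifs
  · positivity
  · exact le_rfl

lemma liveWeight_add_le {z : ℤ} (hz : z ≠ 0) {y : ℤ} (hy : |y| ≤ 1) :
    liveWeight n (z + y) ≤ Real.exp (redRate n * (|(z : ℝ)| + (z.sign * y : ℤ))) := by
  refine (liveWeight_le _).trans (Real.exp_le_exp.2
    (mul_le_mul_of_nonneg_left (le_of_eq ?_) redRate_nonneg))
  rw [abs_le] at hy
  rcases lt_or_gt_of_ne hz with h | h
  · rw [Int.sign_eq_neg_one_of_neg h]
    have h1 : |z + y| = |z| + -1 * y := by rw [abs_of_nonpos (by omega), abs_of_neg h]; ring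
    exact_mod_cast h1
  · rw [Int.sign_eq_one_of_pos h]
    have h1 : |z + y| = |z| + 1 * y := by rw [abs_of_nonneg (by omega), abs_of_pos h]; ring
    exact_mod_cast h1

lemma exp_mul_units (h : ℝ) (u : ℤˣ) :
    Real.exp (h * ((u : ℤ) : ℝ)) = Real.cosh h + ((u : ℤ) : ℝ) * Real.sinh h := by
  rcases Int.units_eq_one_or u with rfl | rfl
  · simp [Real.cosh_add_sinh]
  · simp [← sub_eq_add_neg, Real.cosh_sub_sinh]

lemma redWeight_of_ne {z : ℤ} (hz : z ≠ 0) : redWeight n z = Real.exp (redRate n * |(z : ℝ)|) :=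
  if_neg hz

lemma liveWeight_unit (u : ℤˣ) : liveWeight n u = Real.exp (redRate n) := by
  rcases Int.units_eq_one_or u with rfl | rfl <;> simp [liveWeight]

/-- A move of a chip at `z ≠ 0` by `u`, expressed by the direction of the move relative to `0`. -/
lemma liveWeight_add_unit_le {z : ℤ} (hz : z ≠ 0) (u : ℤˣ) :
    liveWeight n (z + u) ≤ redWeight n z
      * (Real.cosh (redRate n) + ((z.sign * u : ℤ) : ℝ) * Real.sinh (redRate n)) := by
  refine (liveWeight_add_le hz (Int.isUnit_iff_abs_eq.1 u.isUnit).le).trans (le_of_eq ?_)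
  rw [mul_add, Real.exp_add, redWeight_of_ne hz, sign_eq_unitSign hz, ← Units.val_mul,
    exp_mul_units]

lemma liveWeight_add_sub_le (z : ℤ) (u : ℤˣ) :
    (liveWeight n (z + u) + liveWeight n (z - u)) / 2 ≤ Real.cosh (redRate n) * redWeight n z := by
  by_cases hz : z = 0
  · have h1 : liveWeight n (0 - (u : ℤ)) = Real.exp (redRate n) := by
      rw [zero_sub, liveWeight_neg, liveWeight_unit]
    rw [hz, zero_add, h1, liveWeight_unit]
    have h2 := Real.one_le_cosh (redRate n)
    have h3 : redWeight n 0 = 2 * Real.exp (redRate n) := if_pos rfl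
    rw [h3]
    nlinarith [Real.exp_pos (redRate n)]
  · have h1 := liveWeight_add_unit_le (n := n) hz u
    have h2 := liveWeight_add_unit_le (n := n) hz (-u)
    rw [Units.val_neg, ← sub_eq_add_neg] at h2
    push_cast at h1 h2
    linarith

lemma half_le_evenFactor (hn : 0 < n) : 1 / 2 ≤ evenFactor n := by
  have h1 := Real.one_le_cosh (redRate n)
  have h2 : Real.sinh (redRate n) ≤ Real.cosh (redRate n) := (Real.sinh_lt_cosh _).le
  have h3 : 0 ≤ Real.sinh (redRate n) := Real.sinh_nonneg_iff.2 redRate_nonneg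
  have h4 : 2 / 5 / √(n : ℝ) ≤ 2 / 5 := by
    apply div_le_self (by norm_num)
    rw [Real.one_le_sqrt]
    exact_mod_cast hn
  unfold evenFactor
  nlinarith [mul_le_mul_of_nonneg_right h4 h3]

lemma cosh_redRate_le_two (hn : 0 < n) : Real.cosh (redRate n) ≤ 2 := by
  have h0 := redRate_nonneg (n := n)
  have h1 := redRate_le_one hn
  have h2 : redRate n ^ 2 / 2 ≤ 1 / 2 := by nlinarith
  have h3 := (abs_le.1 (Real.abs_exp_sub_one_sub_id_le (x := 1 / 2) (by norm_num [abs_of_pos]))).2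
  have h4 := (Real.cosh_le_exp_half_sq (redRate n)).trans (Real.exp_le_exp.2 h2)
  linarith

lemma evenFactor_le_two (hn : 0 < n) : evenFactor n ≤ 2 := by
  have h3 : 0 ≤ Real.sinh (redRate n) := Real.sinh_nonneg_iff.2 redRate_nonneg
  have : 0 ≤ 2 / 5 / √(n : ℝ) * Real.sinh (redRate n) := by positivity
  unfold evenFactor
  linarith [cosh_redRate_le_two hn]

/-- Over an odd and an even round, the bias of the majority rule outweighs the diffusion. -/
lemma evenFactor_mul_cosh_le (hn : 0 < n) :
    evenFactor n * Real.cosh (redRate n) ≤ 1 - 1 / (50 * n) := by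
  have hn' : (0 : ℝ) < n := by exact_mod_cast hn
  have h0 := redRate_nonneg (n := n)
  have h1 := redRate_le_one hn
  have hs : 0 < √(n : ℝ) := Real.sqrt_pos.2 hn'
  have hss : √(n : ℝ) ^ 2 = n := Real.sq_sqrt hn'.le
  have hc1 := Real.one_le_cosh (redRate n)
  have hsh : redRate n ≤ Real.sinh (redRate n) := Real.self_le_sinh_iff.2 h0
  have hsq : redRate n ^ 2 = 1 / (100 * n) := by
    rw [redRate, div_pow, mul_pow, hss]
    norm_num
  have hb : 2 / 5 / √(n : ℝ) * redRate n = 4 * (1 / (100 * n)) := by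
    have e : 2 / 5 / √(n : ℝ) * (1 / (10 * √n)) = 4 * (1 / (100 * √(n : ℝ) ^ 2)) := by
      field_simp
      ring
    rw [redRate, e, hss]
  have hcc : Real.cosh (redRate n) ^ 2 ≤ 1 + 2 * redRate n ^ 2 := by
    have h2 : redRate n ^ 2 ≤ 1 := by nlinarith
    have h3 := (abs_le.1 (Real.abs_exp_sub_one_sub_id_le (x := redRate n ^ 2)
      (by rwa [abs_of_nonneg (sq_nonneg _)]))).2
    have h4 := pow_le_pow_left₀ (by linarith) (Real.cosh_le_exp_half_sq (redRate n)) 2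
    rw [← Real.exp_nat_mul] at h4
    have e : ((2 : ℕ) : ℝ) * (redRate n ^ 2 / 2) = redRate n ^ 2 := by push_cast; ring
    rw [e] at h4
    nlinarith [sq_nonneg (redRate n)]
  have h5 : 2 / 5 / √(n : ℝ) * redRate n
      ≤ 2 / 5 / √(n : ℝ) * (Real.sinh (redRate n) * Real.cosh (redRate n)) := by
    have : redRate n * 1 ≤ Real.sinh (redRate n) * Real.cosh (redRate n) := by gcongr
    rw [mul_one] at this
    gcongr
  have e : 1 / (50 * (n : ℝ)) = 2 * (1 / (100 * n)) := by
    field_simp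
    norm_num
  rw [e]
  unfold evenFactor
  nlinarith

/-- In an odd round a red chip makes an unbiased step, because the potential rule ignores the
directions of the red chips. -/
lemma expect_liveWeight_odd_le (ht : Odd t) {i : Fin n} (hi : i ∉ s.green) :
    𝔼 r, liveWeight n ((step p c H tie t s r).pos i)
      ≤ Real.cosh (redRate n) * redWeight n (s.pos i) := by
  set flip : Round n → Round n := fun r => (Function.update r.1 i (-r.1 i), r.2) with hflip
  have hinv : Function.Involutive flip := by
    intro r
    simp [hflip]
  have hsign (r : Round n) : chosenSign p c tie t s (flip r) = chosenSign p c tie t s r := by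
    have : mask s.green (fun j => ((flip r).1 j : ℤ)) = mask s.green fun j => (r.1 j : ℤ) := by
      funext j
      by_cases hj : j ∈ s.green
      · have : j ≠ i := fun h => hi (h ▸ hj)
        simp [mask, hflip, this]
      · simp [mask, hj]
    simp only [chosenSign, ht, if_true, potentialRule, this]
    rfl
  have hpos (r : Round n) : (step p c H tie t s (flip r)).pos i
      = s.pos i - (chosenSign p c tie t s r * r.1 i : ℤˣ) := by
    simp only [step, hsign]
    simp [hflip, sub_eq_add_neg]
  have hpos' (r : Round n) : (step p c H tie t s r).pos i
      = s.pos i + (chosenSign p c tie t s r * r.1 i : ℤˣ) := by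
    simp [step]
  have h1 : 𝔼 r, liveWeight n ((step p c H tie t s r).pos i)
      = 𝔼 r, liveWeight n ((step p c H tie t s (flip r)).pos i) :=
    (Fintype.expect_equiv hinv.toPerm _ _ fun r => rfl).symm
  have h2 : 𝔼 r, liveWeight n ((step p c H tie t s r).pos i)
      = 𝔼 r, (liveWeight n ((step p c H tie t s r).pos i)
        + liveWeight n ((step p c H tie t s (flip r)).pos i)) / 2 := by
    rw [← Finset.expect_div, Finset.expect_add_distrib, ← h1, add_self_div_two]
  rw [h2]
  refine Finset.expect_le Finset.univ_nonempty fun r _ => ?_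
  rw [hpos, hpos']
  exact liveWeight_add_sub_le _ _

lemma expect_liveWeight_even_le (hn : 0 < n) (ht : ¬ Odd t) (i : Fin n) :
    𝔼 r, liveWeight n ((step p c H tie t s r).pos i) ≤ evenFactor n * redWeight n (s.pos i) := by
  have hpos (r : Round n) : (step p c H tie t s r).pos i
      = s.pos i + (majorityRule s r * r.1 i : ℤˣ) := by
    simp [step, chosenSign, ht]
  simp only [hpos]
  have hw := one_le_redWeight (n := n) (s.pos i)
  by_cases hz : s.pos i = 0
  · simp only [hz, zero_add, liveWeight_unit, Fintype.expect_const]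
    have h3 : redWeight n 0 = 2 * Real.exp (redRate n) := if_pos rfl
    rw [h3]
    nlinarith [Real.exp_pos (redRate n), half_le_evenFactor hn]
  · refine (Finset.expect_le_expect fun r _ => liveWeight_add_unit_le hz _).trans ?_
    rw [← Finset.mul_expect, Finset.expect_add_distrib, Fintype.expect_const, ← Finset.expect_mul,
      mul_comm]
    refine mul_le_mul_of_nonneg_right ?_ (by linarith)
    have hb := expect_majorityRule_bias s hz
    have e : 𝔼 r : Round n, (((s.pos i).sign * (majorityRule s r * r.1 i : ℤˣ) : ℤ) : ℝ)
        = 𝔼 r : Round n,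
          ((majorityRule s r : ℤ) : ℝ) * (((s.pos i).sign * (r.1 i : ℤ) : ℤ) : ℝ) := by
      refine Finset.expect_congr rfl fun r _ => ?_
      push_cast
      ring
    rw [e]
    have h3 : 0 ≤ Real.sinh (redRate n) := Real.sinh_nonneg_iff.2 redRate_nonneg
    have := mul_le_mul_of_nonneg_right hb h3
    unfold evenFactor
    linarith

/-- Without a reset, only chips that are red and do not reach `0` have a weight after the round.
At a reset the green chips are within `√(c n)` of the origin. -/
lemma redness_step_le (hs : Admissible p c H s.greenPos) (h : Regime p c H n) (i : Fin n)
    (r : Round n) [Decidable (Resets p c H tie t s r)] :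
    redness (step p c H tie t s r) i
      ≤ (if i ∈ s.green then 0 else liveWeight n ((step p c H tie t s r).pos i))
        + resetCost c * if Resets p c H tie t s r then 1 else 0 := by
  have hl := redRate_nonneg (n := n)
  have hl1 := redRate_le_one h.pos
  have hcost : 2 * Real.exp (redRate n) ≤ resetCost c := by
    unfold resetCost
    gcongr
    linarith [Real.sqrt_nonneg c]
  by_cases hr : Resets p c H tie t s r
  · have hg : (step p c H tie t s r).green = ∅ := if_pos hr
    rw [if_pos hr, mul_one, redness, hg, if_neg (Finset.notMem_empty i)]
    by_cases hi : i ∈ s.green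
    · rw [if_pos hi, zero_add]
      by_cases hz : (step p c H tie t s r).pos i = 0
      · rwa [redWeight, if_pos hz]
      · rw [redWeight, if_neg hz, resetCost]
        have h1 := abs_mask_step_sub_le (p := p) (c := c) (H := H) (tie := tie) (t := t)
          (s := s) r i
        have h2 : |((s.greenPos i : ℤ) : ℝ)| ≤ √(c * n) := Real.abs_le_sqrt (hs.1 i).le
        have h3 : mask s.green (step p c H tie t s r).pos i = (step p c H tie t s r).pos i := by
          simp [mask, hi]
        rw [h3] at h1
        have h4 := abs_sub_abs_le_abs_sub (((step p c H tie t s r).pos i : ℤ) : ℝ)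
          ((s.greenPos i : ℤ) : ℝ)
        have h5 : redRate n * |(((step p c H tie t s r).pos i : ℤ) : ℝ)|
            ≤ redRate n * (√(c * n) + 1) := by
          gcongr
          linarith
        have h6 := redRate_mul_sqrt (c := c) h.pos (by linarith [h.one_le_c])
        have h7 : Real.exp (redRate n * |(((step p c H tie t s r).pos i : ℤ) : ℝ)|)
            ≤ Real.exp (√c + 1) := by
          gcongr
          linarith
        linarith [Real.exp_pos (√c + 1)]
    · rw [if_neg hi, redWeight, liveWeight]
      split_ifs
      · linarith
      · linarith [Real.exp_pos (redRate n)]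
  · have hg : (step p c H tie t s r).green = s.green ∪ Finset.univ.filter
      (fun i => (step p c H tie t s r).pos i = 0) := if_neg hr
    rw [if_neg hr, mul_zero, add_zero, redness, hg, redWeight, liveWeight]
    by_cases hi : i ∈ s.green
    · simp [hi]
    · by_cases hz : (step p c H tie t s r).pos i = 0 <;> simp [hi, hz]

open Classical in
/-- The conditional probability of a reset in round `t`. -/
noncomputable def resetProb (p : ℕ) (c H : ℝ) {n : ℕ} (tie : TieRule n) (t : ℕ) (s : State n) : ℝ :=
  𝔼 r, if Resets p c H tie t s r then (1 : ℝ) else 0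

open Classical in
lemma expect_redness_step_le (hs : Admissible p c H s.greenPos) (h : Regime p c H n) (i : Fin n) :
    𝔼 r, redness (step p c H tie t s r) i
      ≤ (if Odd t then Real.cosh (redRate n) else evenFactor n) * redness s i
        + resetCost c * resetProb p c H tie t s := by
  refine (Finset.expect_le_expect fun r _ => redness_step_le hs h i r).trans ?_
  rw [Finset.expect_add_distrib, ← Finset.mul_expect, resetProb, redness]
  gcongr
  by_cases hi : i ∈ s.green
  · simp [hi]
  · simp only [hi, if_false]
    by_cases ht : Odd t
    · rw [if_pos ht]
      exact expect_liveWeight_odd_le ht hi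
    · rw [if_neg ht]
      exact expect_liveWeight_even_le h.pos ht i

open Classical in
lemma resetProb_le (hs : Admissible p c H s.greenPos) (h : Regime p c H n) :
    resetProb p c H tie t s ≤ Real.exp (1 - rate p H n * H) * expPotential p c H s :=
  Finset.expect_le Finset.univ_nonempty fun r _ => hs.indicator_resets_le h r

end Red

/-! ### Bounds that are uniform in the number of rounds -/

/-- The mean of `f` over the state after `T` rounds. -/
noncomputable def mean (p : ℕ) (c H : ℝ) {n : ℕ} (tie : TieRule n) (T : ℕ) (f : State n → ℝ) : ℝ :=
  𝔼 ω : Fin T → Round n, f (run p c H tie T ω)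

section Mean

variable {p n : ℕ} {c H : ℝ} {tie : TieRule n}

lemma mean_zero (f : State n → ℝ) : mean p c H tie 0 f = f (State.init n) :=
  Fintype.expect_const _

lemma mean_succ (T : ℕ) (f : State n → ℝ) :
    mean p c H tie (T + 1) f = mean p c H tie T fun s => 𝔼 r, f (step p c H tie (T + 1) s r) := by
  unfold mean
  rw [Finset.expect_comm, ← Finset.expect_product', Finset.univ_product_univ]
  refine (Fintype.expect_equiv (Fin.snocEquiv fun _ => Round n) _ _ fun x => ?_).symm
  simp [Fin.snocEquiv, run]

lemma admissible_run (h : Regime p c H n) (T : ℕ) (ω : Fin T → Round n) :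
    Admissible p c H (run p c H tie T ω).greenPos := by
  induction T with
  | zero =>
    have : (State.init n).greenPos = 0 := by
      funext i
      simp [State.greenPos, State.init, mask]
    rw [run, this]
    exact admissible_zero h
  | succ T ih => exact (ih _).step h _

lemma mean_mono (h : Regime p c H n) (T : ℕ) {f g : State n → ℝ}
    (hfg : ∀ s : State n, Admissible p c H s.greenPos → f s ≤ g s) :
    mean p c H tie T f ≤ mean p c H tie T g :=
  Finset.expect_le_expect fun ω _ => hfg _ (admissible_run h T ω)

lemma mean_mul_add (T : ℕ) (a b : ℝ) (f : State n → ℝ) :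
    mean p c H tie T (fun s => a * f s + b) = a * mean p c H tie T f + b := by
  unfold mean
  rw [Finset.expect_add_distrib, ← Finset.mul_expect, Fintype.expect_const]

lemma decay_pos (h : Regime p c H n) : 0 < decay p c H n := by
  have := rate_pos h
  have := h.n_pos
  have : 0 < √c := Real.sqrt_pos.2 (by linarith [h.one_le_c])
  unfold decay
  positivity

lemma decay_le_one (h : Regime p c H n) : decay p c H n ≤ 1 :=
  (admissible_run (tie := fun _ _ _ _ => 1) h 0 Fin.elim0).decay_le_one h

lemma mean_expPotential_le_of_even (h : Regime p c H n) (k : ℕ) :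
    mean p c H tie (2 * k) (expPotential p c H)
      ≤ Real.exp (rate p H n * (H / 2) + 2) / decay p c H n := by
  have hdec := decay_pos h
  have hdec1 := decay_le_one h
  induction k with
  | zero =>
    have h0 : (State.init n).greenPos = 0 := by
      funext i
      simp [State.greenPos, State.init, mask]
    rw [mul_zero, mean_zero, expPotential, h0, potential_zero h.p_pos h.pos
      (by linarith [h.one_le_c])]
    refine le_trans ?_ (le_div_self (Real.exp_pos _).le hdec hdec1)
    have hH : 1 ≤ H / 2 := by
      have := h.exp_le
      have := Real.add_one_le_exp (3 : ℝ)
      linarith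
    have := mul_le_mul_of_nonneg_left hH (rate_pos h).le
    gcongr
    linarith
  | succ k ih =>
    rw [mul_add, mul_one, mean_succ, mean_succ]
    refine (mean_mono h _ fun s hs => hs.expect_expPotential_two_steps_le_add h
      ((even_two_mul k).add_one)).trans ?_
    rw [mean_mul_add]
    have h1 := mul_le_mul_of_nonneg_left ih (sub_nonneg.2 hdec1)
    set B := Real.exp (rate p H n * (H / 2) + 2)
    have h2 : decay p c H n * (B / decay p c H n) = B := by field_simp
    linarith

lemma mean_expPotential_le (h : Regime p c H n) (T : ℕ) :
    mean p c H tie T (expPotential p c H)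
      ≤ Real.exp (rate p H n * (H / 2) + 3) / decay p c H n := by
  have hdec := decay_pos h
  have e : Real.exp (rate p H n * (H / 2) + 3)
      = Real.exp 1 * Real.exp (rate p H n * (H / 2) + 2) := by
    rw [← Real.exp_add]
    ring_nf
  rcases Nat.even_or_odd' T with ⟨k, rfl | rfl⟩
  · refine (mean_expPotential_le_of_even h k).trans ?_
    gcongr
    norm_num
  · rw [mean_succ, e, mul_div_assoc]
    calc _ ≤ mean p c H tie (2 * k) (fun s => Real.exp 1 * expPotential p c H s + 0) :=
          mean_mono h _ fun s hs => Finset.expect_le Finset.univ_nonempty fun r _ => by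
            rw [add_zero]
            exact hs.expPotential_step_le_mul h r
      _ = Real.exp 1 * mean p c H tie (2 * k) (expPotential p c H) := by rw [mean_mul_add, add_zero]
      _ ≤ _ := by
        gcongr
        exact mean_expPotential_le_of_even h k

/-- A bound for the probability that a new phase begins in a given round. -/
noncomputable def resetBound (p : ℕ) (c H : ℝ) (n : ℕ) : ℝ :=
  Real.exp (4 - rate p H n * (H / 2)) / decay p c H n

lemma resetBound_pos (h : Regime p c H n) : 0 < resetBound p c H n :=
  div_pos (Real.exp_pos _) (decay_pos h)

lemma mean_resetProb_le (h : Regime p c H n) (T : ℕ) :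
    mean p c H tie T (resetProb p c H tie (T + 1)) ≤ resetBound p c H n := by
  calc _ ≤ mean p c H tie T
        (fun s => Real.exp (1 - rate p H n * H) * expPotential p c H s + 0) :=
        mean_mono h T fun s hs => by
          rw [add_zero]
          exact resetProb_le hs h
    _ = Real.exp (1 - rate p H n * H) * mean p c H tie T (expPotential p c H) := by
        rw [mean_mul_add, add_zero]
    _ ≤ Real.exp (1 - rate p H n * H)
        * (Real.exp (rate p H n * (H / 2) + 3) / decay p c H n) := by
        gcongr
        exact mean_expPotential_le h T
    _ = _ := by
        rw [resetBound, ← mul_div_assoc, ← Real.exp_add]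
        ring_nf

lemma resetCost_pos : 0 < resetCost c := by
  unfold resetCost
  positivity

lemma mean_redness_succ_le (h : Regime p c H n) (T : ℕ) (i : Fin n) :
    mean p c H tie (T + 1) (redness · i)
      ≤ (if Odd (T + 1) then Real.cosh (redRate n) else evenFactor n)
          * mean p c H tie T (redness · i)
        + resetCost c * resetBound p c H n := by
  rw [mean_succ]
  refine (mean_mono h T fun s hs => expect_redness_step_le hs h i).trans ?_
  have h1 := mul_le_mul_of_nonneg_left (mean_resetProb_le (tie := tie) h T)
    (resetCost_pos (c := c)).le
  refine le_trans (le_of_eq ?_) (add_le_add_right h1 _)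
  unfold mean
  rw [Finset.expect_add_distrib, ← Finset.mul_expect, ← Finset.mul_expect]

lemma mean_redness_le_of_even (h : Regime p c H n) (k : ℕ) (i : Fin n) :
    mean p c H tie (2 * k) (redness · i) ≤ 150 * n * (resetCost c * resetBound p c H n) := by
  have hn := h.n_pos
  have hδ : 0 < resetCost c * resetBound p c H n := mul_pos resetCost_pos (resetBound_pos h)
  set δ := resetCost c * resetBound p c H n
  induction k with
  | zero =>
    rw [mul_zero, mean_zero]
    have : redness (State.init n) i = 0 := by simp [redness, State.init]
    rw [this]
    positivity
  | succ k ih =>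
    have h1 := mean_redness_succ_le (tie := tie) h (2 * k) i
    have h2 := mean_redness_succ_le (tie := tie) h (2 * k + 1) i
    rw [if_pos (even_two_mul k).add_one] at h1
    rw [if_neg (Nat.not_odd_iff_even.2 (even_two_mul k).add_one.add_one)] at h2
    have h3 := half_le_evenFactor h.pos
    have h4 := evenFactor_le_two h.pos
    have h5 := evenFactor_mul_cosh_le h.pos
    have h0 : 0 ≤ mean p c H tie (2 * k) (redness · i) :=
      Finset.expect_nonneg fun ω _ => redness_nonneg _ i
    have h6 := mul_le_mul_of_nonneg_left h1 (by linarith : 0 ≤ evenFactor n)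
    have h7 := mul_le_mul_of_nonneg_right h5 h0
    have h8 := mul_le_mul_of_nonneg_right h4 hδ.le
    have h9 : 1 / (50 * (n : ℝ)) ≤ 1 := by
      rw [div_le_one (by positivity)]
      linarith [h.one_le_n]
    have h10 := mul_le_mul_of_nonneg_left ih (sub_nonneg.2 h9)
    have h11 : (1 - 1 / (50 * (n : ℝ))) * (150 * n * δ) = 150 * n * δ - 3 * δ := by
      field_simp
      ring
    have e : 2 * (k + 1) = 2 * k + 1 + 1 := by ring
    rw [e]
    linarith

/-- At any given time, a given chip is red only with a tiny probability: its weight is created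
only by resets and decays between them. -/
lemma mean_redness_le (h : Regime p c H n) (T : ℕ) (i : Fin n) :
    mean p c H tie T (redness · i) ≤ 301 * n * (resetCost c * resetBound p c H n) := by
  have hn := h.one_le_n
  have hδ : 0 < resetCost c * resetBound p c H n := mul_pos resetCost_pos (resetBound_pos h)
  rcases Nat.even_or_odd' T with ⟨k, rfl | rfl⟩
  · refine (mean_redness_le_of_even h k i).trans ?_
    gcongr
    norm_num
  · have h1 := mean_redness_succ_le (tie := tie) h (2 * k) i
    rw [if_pos (even_two_mul k).add_one] at h1
    have h0 : 0 ≤ mean p c H tie (2 * k) (redness · i) :=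
      Finset.expect_nonneg fun ω _ => redness_nonneg _ i
    have h2 := mul_le_mul_of_nonneg_right (cosh_redRate_le_two h.pos) h0
    have h3 := mean_redness_le_of_even (tie := tie) h k i
    nlinarith [mul_le_mul_of_nonneg_right hn hδ.le]

lemma abs_pos_le_of_green {s : State n} (hs : Admissible p c H s.greenPos) {i : Fin n}
    (hi : i ∈ s.green) : |((s.pos i : ℤ) : ℝ)| ≤ √(c * n) := by
  have h1 := hs.1 i
  have h2 : s.greenPos i = s.pos i := by simp [State.greenPos, mask, hi]
  rw [h2] at h1
  exact Real.abs_le_sqrt h1.le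

open Classical in
lemma probValueLE_eq (T : ℕ) (B : ℝ) : probValueLE p c H tie T B
    = 𝔼 ω : Fin T → Round n, if value p c H tie T ω ≤ B then (1 : ℝ) else 0 := by
  rw [probValueLE, PMF.toOuterMeasure_uniformOfFintype_apply, Fintype.expect_eq_sum_div_card,
    Finset.sum_boole, ENNReal.toReal_div, ENNReal.toReal_natCast, ENNReal.toReal_natCast]
  congr 2
  exact Fintype.card_subtype _

lemma one_sub_le_probValueLE (h : Regime p c H n) (T : ℕ) :
    1 - 301 * n ^ 2 * (resetCost c * resetBound p c H n)
      ≤ probValueLE p c H tie T (√c * √n) := by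
  classical
  have h1 : ∑ i : Fin n, mean p c H tie T (redness · i)
      ≤ 301 * n ^ 2 * (resetCost c * resetBound p c H n) := by
    refine (Finset.sum_le_sum fun i _ => mean_redness_le h T i).trans (le_of_eq ?_)
    rw [Finset.sum_const, Finset.card_univ, Fintype.card_fin, nsmul_eq_mul]
    ring
  have h2 : 1 - ∑ i : Fin n, mean p c H tie T (redness · i)
      = 𝔼 ω : Fin T → Round n, (1 - ∑ i, redness (run p c H tie T ω) i) := by
    rw [Finset.expect_sub_distrib, Fintype.expect_const, Finset.expect_sum_comm]
    rfl
  rw [probValueLE_eq]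
  refine le_trans (by linarith : _ ≤ 1 - ∑ i : Fin n, mean p c H tie T (redness · i)) ?_
  rw [h2]
  refine Finset.expect_le_expect fun ω _ => ?_
  have hnn : 0 ≤ ∑ i, redness (run p c H tie T ω) i :=
    Finset.sum_nonneg fun i _ => redness_nonneg _ i
  split_ifs with hv
  · linarith
  -- on failure some chip is red, and its weight is at least `1`
  · obtain ⟨i, hi⟩ : ∃ i, i ∉ (run p c H tie T ω).green := by
      by_contra! hall
      refine hv ((pi_norm_le_iff_of_nonneg (by positivity)).2 fun i => ?_)
      rw [← Real.sqrt_mul (by linarith [h.one_le_c])]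
      exact abs_pos_le_of_green (admissible_run h T ω) (hall i)
    have h3 : 1 ≤ redness (run p c H tie T ω) i := by
      rw [redness, if_neg hi]
      exact one_le_redWeight _
    have h4 := Finset.single_le_sum (f := fun i => redness (run p c H tie T ω) i)
      (fun i _ => redness_nonneg _ i) (Finset.mem_univ i)
    linarith

end Mean

/-! ### The failure probability tends to `0` -/

open Filter Topology in
lemma tendsto_failure {p : ℕ} {c H : ℝ} (hp : 0 < p) (hc : 0 < c) (hH : 0 < H) :
    Tendsto (fun n : ℕ => 301 * (n : ℝ) ^ 2 * (resetCost c * resetBound p c H n)) atTop (𝓝 0) := by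
  set a : ℝ := (1440 * p ^ 2 * 4 ^ (p + 1) * H ^ 2)⁻¹ with ha
  have hp' : (0 : ℝ) < p := by exact_mod_cast hp
  have ha0 : 0 < a := by positivity
  have hrate (n : ℕ) : rate p H n = a * √√n := by
    rw [rate, ha]
    field_simp
  have hy : Tendsto (fun n : ℕ => a * √√(n : ℝ) * (H / 2)) atTop atTop := by
    refine Tendsto.atTop_mul_const (by positivity) (Tendsto.const_mul_atTop ha0 ?_)
    exact Real.tendsto_sqrt_atTop.comp (Real.tendsto_sqrt_atTop.comp tendsto_natCast_atTop_atTop)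
  have hlim := (Real.tendsto_pow_mul_exp_neg_atTop_nhds_zero 11).comp hy
  have hlim' := hlim.const_mul
    (3010 * resetCost c * √c * Real.exp 4 / a * (2 / (a * H)) ^ 11)
  rw [mul_zero] at hlim'
  refine hlim'.congr' ?_
  filter_upwards [eventually_gt_atTop 0] with n hn
  have hn' : (0 : ℝ) < n := by exact_mod_cast hn
  set y := √√(n : ℝ) with hydef
  have hy0 : 0 < y := Real.sqrt_pos.2 (Real.sqrt_pos.2 hn')
  have hny : (n : ℝ) = y ^ 4 := by
    rw [hydef, show (4 : ℕ) = 2 * 2 from rfl, pow_mul, Real.sq_sqrt (Real.sqrt_nonneg _),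
      Real.sq_sqrt hn'.le]
  have hsc : 0 < √c := Real.sqrt_pos.2 hc
  simp only [Function.comp, resetBound, decay, hrate, ← hydef]
  rw [sub_eq_add_neg, Real.exp_add, hny]
  field_simp
  ring

end ChipGame

theorem mainTheorem3 (p : ℕ) (hp : 4 ≤ p) (H : ℝ) (hH : 4 * Real.exp 3 ≤ H) :
    ∃ c₀ : ℝ, 0 < c₀ ∧ ∀ c : ℝ, c₀ ≤ c →
      ∃ K : ℝ, 0 < K ∧ ∀ ε : ℝ, 0 < ε →
        ∃ N : ℕ, ∀ n : ℕ, N ≤ n → ∀ (tie : ChipGame.TieRule n) (T : ℕ),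
          1 - ε ≤ ChipGame.probValueLE p c H tie T (K * Real.sqrt n) := by
  have hp0 : (0 : ℝ) < p := by exact_mod_cast (by omega : 0 < p)
  have hH0 : 0 < H := lt_of_lt_of_le (by positivity) hH
  have hc₀ : 0 < H * (440 * (p : ℝ) ^ 2 * 2 ^ (p + 1)) ^ 2 := by positivity
  refine ⟨H * (440 * p ^ 2 * 2 ^ (p + 1)) ^ 2, hc₀, fun c hc => ?_⟩
  have hc0 : 0 < c := hc₀.trans_le hc
  refine ⟨√c, Real.sqrt_pos.2 hc0, fun ε hε => ?_⟩
  obtain ⟨N, hN⟩ := Filter.eventually_atTop.1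
    ((ChipGame.tendsto_failure (by omega : 0 < p) hc0 hH0).eventually (gt_mem_nhds hε))
  refine ⟨max N 1, fun n hn tie T => ?_⟩
  have hreg : ChipGame.Regime p c H n := ⟨hp, hH, (le_max_right N 1).trans hn, hc⟩
  have h1 := hN n ((le_max_left N 1).trans hn)
  have h2 := ChipGame.one_sub_le_probValueLE (tie := tie) hreg T
  linarith
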